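/- Let $M$ be a smooth (Hausdorff, second countable) manifold of dimension $d$. Let $\mathcal G(M)=\mathcal E_M(M)/\mathcal N(M)$ be the (special) Colombeau algebra of $M$: nets $(u_\varepsilon)_{\varepsilon\in(0,1]}$ in $C^\infty(M)$ all of whose derivatives are, uniformly on compact sets, $O(\varepsilon^{-N})$ for some $N$ as $\varepsilon\to0$, modulo those moderate nets which are $O(\varepsilon^{m})$ for every $m$, uniformly on compact sets. For a vector bundle $V\to M$ let $\Gamma_{\mathcal G}(V)$ be the $\mathcal G(M)$-module of generalized sections, defined in the same way from nets of smooth sections, and write $\mathfrak X_{\mathcal G}(M)=\Gamma_{\mathcal G}(TM)$, $\Omega^k_{\mathcal G}(M)=\Gamma_{\mathcal G}(\Lambda^kT^*M)$. Operations such as $\alpha(X)$, $\sigma(X,Y)$, $d$ are defined $\varepsilon$-wise on representatives. Let $\widetilde{\mathbb R}$ be the ring of generalized numbers (moderate nets of reals modulo negligible nets). Let $\sigma$ be a generalized symplectic form on $M$, that is, a generalized $2$-form $\sigma\in\Omega^2_{\mathcal G}(M)$ which is closed ($d\sigma=0$ in $\Omega^3_{\mathcal G}(M)$) and non-degenerate: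 for every chart $(W,\psi)$ and every compactly supported generalized point $\tilde z$ of $\psi(W)$, the $\widetilde{\mathbb R}$-bilinear form $(\psi_*\sigma)(\tilde z)$ on $\widetilde{\mathbb R}^d$ is non-degenerate. Then for every $X\in\mathfrak X_{\mathcal G}(M)$ there is a unique $\sigma_\flat(X)\in\Omega^1_{\mathcal G}(M)$ with $\sigma_\flat(X)(Y)=\sigma(X,Y)$ for all $Y\in\mathfrak X_{\mathcal G}(M)$, namely the class of $(\sigma_\varepsilon(X_\varepsilon,\cdot))_\varepsilon$, and the map $$\sigma_\flat:\mathfrak X_{\mathcal G}(M)\to\Omega^1_{\mathcal G}(M),\qquad \sigma_\flat(X)(Y)=\sigma(X,Y),$$ is a $\mathcal G(M)$-linear isomorphism. Denote its inverse by $\sigma^\sharp$. Consequently, every $f\in\mathcal G(M)$ has a well-defined Hamiltonian vector field $H_f=\sigma^\sharp(df)$, the unique $X\in\mathfrak X_{\mathcal G}(M)$ with $\sigma_\flat(X)=df$, and the Poisson bracket $\{f,g\}=\sigma(H_f,H_g)\in\mathcal G(M)$ of $f,g\in\mathcal G(M)$ is well defined. -/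

import Mathlib

open scoped Manifold ContDiff Topology
open Set Filter Bundle

noncomputable section

namespace Colombeau

/-! ### Asymptotic growth of nets -/

/-- The index set `]0,1]` of all nets. -/
abbrev Eps : Type := Set.Ioc (0 : ℝ) 1

/-- The filter `ε → 0` on `]0,1]`. -/
def epsZero : Filter Eps := Filter.comap (fun ε : Eps => (ε : ℝ)) (𝓝 0)

/-- `sup_{x ∈ K} ‖u_ε(x)‖ = O(ε^{-N})` for some `N`, as `ε → 0`. -/
def ModerateOn {X F : Type*} [Norm F] (K : Set X) (u : Eps → X → F) : Prop :=
  ∃ N : ℕ, ∃ C : ℝ, ∀ᶠ ε in epsZero, ∀ x ∈ K, ‖u ε x‖ ≤ C * ((ε : ℝ)⁻¹) ^ N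

/-- `sup_{x ∈ K} ‖u_ε(x)‖ = O(ε^m)` for all `m`, as `ε → 0`. -/
def NegligibleOn {X F : Type*} [Norm F] (K : Set X) (u : Eps → X → F) : Prop :=
  ∀ m : ℕ, ∃ C : ℝ, ∀ᶠ ε in epsZero, ∀ x ∈ K, ‖u ε x‖ ≤ C * (ε : ℝ) ^ m

section Growth

variable {X F F₁ F₂ F₃ : Type*} [NormedAddCommGroup F] [NormedAddCommGroup F₁]
  [NormedAddCommGroup F₂] [NormedAddCommGroup F₃] {K : Set X}

theorem ModerateOn.mono_le {u : Eps → X → F₁} {w : Eps → X → F₂} (hu : ModerateOn K u)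
    (h : ∀ ε, ∀ x ∈ K, ‖w ε x‖ ≤ ‖u ε x‖) : ModerateOn K w := by
  obtain ⟨N, C, h1⟩ := hu
  exact ⟨N, C, h1.mono fun ε hε x hx => (h ε x hx).trans (hε x hx)⟩

theorem NegligibleOn.mono_le {u : Eps → X → F₁} {w : Eps → X → F₂} (hu : NegligibleOn K u)
    (h : ∀ ε, ∀ x ∈ K, ‖w ε x‖ ≤ ‖u ε x‖) : NegligibleOn K w := by
  intro m
  obtain ⟨C, h1⟩ := hu m
  exact ⟨C, h1.mono fun ε hε x hx => (h ε x hx).trans (hε x hx)⟩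

theorem ModerateOn.congr {u w : Eps → X → F} (hu : ModerateOn K u)
    (h : ∀ ε, ∀ x ∈ K, w ε x = u ε x) : ModerateOn K w :=
  hu.mono_le fun ε x hx => by rw [h ε x hx]

theorem NegligibleOn.congr {u w : Eps → X → F} (hu : NegligibleOn K u)
    (h : ∀ ε, ∀ x ∈ K, w ε x = u ε x) : NegligibleOn K w :=
  hu.mono_le fun ε x hx => by rw [h ε x hx]

theorem ModerateOn.nonneg {u : Eps → X → F} (hu : ModerateOn K u) :
    ∃ N : ℕ, ∃ C : ℝ, 0 ≤ C ∧ ∀ᶠ ε in epsZero, ∀ x ∈ K, ‖u ε x‖ ≤ C * ((ε : ℝ)⁻¹) ^ N := by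
  obtain ⟨N, C, h⟩ := hu
  refine ⟨N, |C|, abs_nonneg _, h.mono fun ε hε x hx => (hε x hx).trans ?_⟩
  have := ε.2.1
  gcongr
  exact le_abs_self C

theorem moderateOn_bound {u : Eps → X → F} (C : ℝ) (h : ∀ ε, ∀ x ∈ K, ‖u ε x‖ ≤ C) :
    ModerateOn K u :=
  ⟨0, C, Eventually.of_forall fun ε x hx => by simpa using h ε x hx⟩

theorem ModerateOn.add {u v : Eps → X → F} (hu : ModerateOn K u) (hv : ModerateOn K v) :
    ModerateOn K (fun ε x => u ε x + v ε x) := by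
  obtain ⟨N, C, hC, h1⟩ := hu.nonneg
  obtain ⟨N', C', hC', h2⟩ := hv.nonneg
  refine ⟨N + N', C + C', ?_⟩
  filter_upwards [h1, h2] with ε h1 h2 x hx
  have hε : (1 : ℝ) ≤ (ε : ℝ)⁻¹ := (one_le_inv₀ ε.2.1).2 ε.2.2
  have e1 : ((ε : ℝ)⁻¹) ^ N ≤ ((ε : ℝ)⁻¹) ^ (N + N') := pow_le_pow_right₀ hε (by omega)
  have e2 : ((ε : ℝ)⁻¹) ^ N' ≤ ((ε : ℝ)⁻¹) ^ (N + N') := pow_le_pow_right₀ hε (by omega)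
  calc ‖u ε x + v ε x‖ ≤ ‖u ε x‖ + ‖v ε x‖ := norm_add_le _ _
    _ ≤ C * ((ε : ℝ)⁻¹) ^ N + C' * ((ε : ℝ)⁻¹) ^ N' := add_le_add (h1 x hx) (h2 x hx)
    _ ≤ C * ((ε : ℝ)⁻¹) ^ (N + N') + C' * ((ε : ℝ)⁻¹) ^ (N + N') := by gcongr
    _ = _ := by ring

theorem NegligibleOn.add {u v : Eps → X → F} (hu : NegligibleOn K u) (hv : NegligibleOn K v) :
    NegligibleOn K (fun ε x => u ε x + v ε x) := by
  intro m
  obtain ⟨C, h1⟩ := hu m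
  obtain ⟨C', h2⟩ := hv m
  refine ⟨C + C', ?_⟩
  filter_upwards [h1, h2] with ε h1 h2 x hx
  rw [add_mul]
  exact (norm_add_le _ _).trans (add_le_add (h1 x hx) (h2 x hx))

theorem ModerateOn.mul_le {u : Eps → X → F₁} {v : Eps → X → F₂} {w : Eps → X → F₃}
    (hu : ModerateOn K u) (hv : ModerateOn K v) (c : ℝ)
    (h : ∀ ε, ∀ x ∈ K, ‖w ε x‖ ≤ c * (‖u ε x‖ * ‖v ε x‖)) : ModerateOn K w := by
  obtain ⟨N, C, hC, h1⟩ := hu.nonneg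
  obtain ⟨N', C', hC', h2⟩ := hv.nonneg
  refine ⟨N + N', |c| * (C * C'), ?_⟩
  filter_upwards [h1, h2] with ε h1 h2 x hx
  have hε := ε.2.1
  calc ‖w ε x‖ ≤ c * (‖u ε x‖ * ‖v ε x‖) := h ε x hx
    _ ≤ |c| * (‖u ε x‖ * ‖v ε x‖) := by gcongr; exact le_abs_self c
    _ ≤ |c| * ((C * ((ε : ℝ)⁻¹) ^ N) * (C' * ((ε : ℝ)⁻¹) ^ N')) := by
        gcongr
        · exact h1 x hx
        · exact h2 x hx
    _ = _ := by ring

theorem NegligibleOn.mul_le {u : Eps → X → F₁} {v : Eps → X → F₂} {w : Eps → X → F₃}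
    (hu : ModerateOn K u) (hv : NegligibleOn K v) (c : ℝ)
    (h : ∀ ε, ∀ x ∈ K, ‖w ε x‖ ≤ c * (‖u ε x‖ * ‖v ε x‖)) : NegligibleOn K w := by
  intro m
  obtain ⟨N, C, hC, h1⟩ := hu.nonneg
  obtain ⟨C', h2⟩ := hv (m + N)
  refine ⟨|c| * (C * |C'|), ?_⟩
  filter_upwards [h1, h2] with ε h1 h2 x hx
  have hε := ε.2.1
  calc ‖w ε x‖ ≤ c * (‖u ε x‖ * ‖v ε x‖) := h ε x hx
    _ ≤ |c| * (‖u ε x‖ * ‖v ε x‖) := by gcongr; exact le_abs_self c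
    _ ≤ |c| * ((C * ((ε : ℝ)⁻¹) ^ N) * (|C'| * (ε : ℝ) ^ (m + N))) := by
        gcongr
        · exact h1 x hx
        · exact (h2 x hx).trans (by gcongr; exact le_abs_self _)
    _ = |c| * (C * |C'|) * (ε : ℝ) ^ m * (((ε : ℝ)⁻¹) ^ N * (ε : ℝ) ^ N) := by ring
    _ = _ := by rw [← mul_pow, inv_mul_cancel₀ hε.ne', one_pow, mul_one]

theorem ModerateOn.sum {ι : Type*} (s : Finset ι) {u : ι → Eps → X → F}
    (h : ∀ i ∈ s, ModerateOn K (u i)) : ModerateOn K (fun ε x => ∑ i ∈ s, u i ε x) := by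
  classical
  induction s using Finset.induction_on with
  | empty => exact moderateOn_bound 0 (by simp)
  | insert a s ha ih =>
    simp only [Finset.sum_insert ha]
    exact (h a (by simp)).add (ih fun i hi => h i (by simp [hi]))

theorem negligibleOn_zero : NegligibleOn K (fun _ _ => (0 : F)) :=
  fun m => ⟨0, by simp⟩

end Growth

/-! ### Nets of smooth functions on an open subset of a vector space -/

section Local

variable {E F F₁ F₂ F₃ : Type*} [NormedAddCommGroup E] [NormedSpace ℝ E]
  [NormedAddCommGroup F] [NormedSpace ℝ F] [NormedAddCommGroup F₁] [NormedSpace ℝ F₁]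
  [NormedAddCommGroup F₂] [NormedSpace ℝ F₂] [NormedAddCommGroup F₃] [NormedSpace ℝ F₃]

/-- All derivatives of the net grow at most polynomially in `1/ε` on compact subsets of `U`. -/
def LocModerate (U : Set E) (u : Eps → E → F) : Prop :=
  ∀ K ⊆ U, IsCompact K → ∀ k : ℕ, ModerateOn K (fun ε => iteratedFDeriv ℝ k (u ε))

/-- The net is `O(ε^m)` for every `m`, uniformly on compact subsets of `U`. -/
def LocNegligible (U : Set E) (u : Eps → E → F) : Prop :=
  ∀ K ⊆ U, IsCompact K → NegligibleOn K u

variable {U : Set E}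

theorem LocModerate.moderateOn {u : Eps → E → F} (hu : LocModerate U u) {K : Set E} (hK : K ⊆ U)
    (hc : IsCompact K) : ModerateOn K u :=
  (hu K hK hc 0).mono_le fun ε _ _ => by simp

theorem LocModerate.congr (hU : IsOpen U) {u v : Eps → E → F} (hu : LocModerate U u)
    (h : ∀ ε, EqOn (v ε) (u ε) U) : LocModerate U v := by
  intro K hK hc k
  refine (hu K hK hc k).congr fun ε x hx => ?_
  exact (((h ε).eventuallyEq_of_mem (hU.mem_nhds (hK hx))).iteratedFDeriv ℝ k).eq_of_nhds

theorem LocNegligible.congr {u v : Eps → E → F} (hu : LocNegligible U u)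
    (h : ∀ ε, EqOn (v ε) (u ε) U) : LocNegligible U v :=
  fun K hK hc => (hu K hK hc).congr fun ε x hx => h ε (hK hx)

theorem LocModerate.add (hU : IsOpen U) {u v : Eps → E → F}
    (hus : ∀ ε, ContDiffOn ℝ ∞ (u ε) U) (hvs : ∀ ε, ContDiffOn ℝ ∞ (v ε) U)
    (hu : LocModerate U u) (hv : LocModerate U v) :
    LocModerate U (fun ε x => u ε x + v ε x) := by
  intro K hK hc k
  refine ((hu K hK hc k).add (hv K hK hc k)).congr fun ε x hx => ?_
  have hn := hU.mem_nhds (hK hx)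
  exact iteratedFDeriv_add_apply (((hus ε).contDiffAt hn).of_le (by exact_mod_cast le_top))
    (((hvs ε).contDiffAt hn).of_le (by exact_mod_cast le_top))

theorem LocModerate.const (c : F) : LocModerate U (fun (_ : Eps) (_ : E) => c) := by
  intro K hK hc k
  rcases Nat.eq_zero_or_pos k with rfl | hk
  · exact moderateOn_bound ‖c‖ (by simp)
  · exact moderateOn_bound 0 (by simp [iteratedFDeriv_const_of_ne hk.ne'])

/-- Leibniz rule: bilinear images of moderate nets are moderate. -/
theorem LocModerate.bilin (hU : IsOpen U) (B : F₁ →L[ℝ] F₂ →L[ℝ] F₃) {u : Eps → E → F₁}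
    {v : Eps → E → F₂} (hus : ∀ ε, ContDiffOn ℝ ∞ (u ε) U) (hvs : ∀ ε, ContDiffOn ℝ ∞ (v ε) U)
    (hu : LocModerate U u) (hv : LocModerate U v) :
    LocModerate U (fun ε x => B (u ε x) (v ε x)) := by
  intro K hK hc k
  have key : ModerateOn K (fun ε x => ∑ i ∈ Finset.range (k + 1),
      ‖B‖ * ((k.choose i : ℝ) * ‖iteratedFDeriv ℝ i (u ε) x‖ *
        ‖iteratedFDeriv ℝ (k - i) (v ε) x‖)) := by
    refine ModerateOn.sum _ fun i _ => ?_
    refine (hu K hK hc i).mul_le (hv K hK hc (k - i)) (‖B‖ * k.choose i) fun ε x _ => ?_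
    rw [Real.norm_of_nonneg (by positivity)]
    apply le_of_eq
    ring
  refine key.mono_le fun ε x hx => ?_
  rw [Real.norm_of_nonneg (by positivity), ← Finset.mul_sum]
  have := B.norm_iteratedFDerivWithin_le_of_bilinear (hus ε) (hvs ε) hU.uniqueDiffOn (hK hx)
    (n := k) (by exact_mod_cast le_top)
  rw [iteratedFDerivWithin_of_isOpen k hU (hK hx)] at this
  refine this.trans (le_of_eq ?_)
  congr 1
  refine Finset.sum_congr rfl fun i _ => ?_
  rw [iteratedFDerivWithin_of_isOpen i hU (hK hx),
    iteratedFDerivWithin_of_isOpen (k - i) hU (hK hx)]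

theorem LocNegligible.add {u v : Eps → E → F} (hu : LocNegligible U u) (hv : LocNegligible U v) :
    LocNegligible U (fun ε x => u ε x + v ε x) :=
  fun K hK hc => (hu K hK hc).add (hv K hK hc)

theorem LocNegligible.bilin_right (B : F₁ →L[ℝ] F₂ →L[ℝ] F₃) {u : Eps → E → F₁}
    {v : Eps → E → F₂} (hu : LocModerate U u) (hv : LocNegligible U v) :
    LocNegligible U (fun ε x => B (u ε x) (v ε x)) := fun K hK hc =>
  NegligibleOn.mul_le (hu.moderateOn hK hc) (hv K hK hc) ‖B‖ fun ε x _ => by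
    rw [← mul_assoc]; exact B.le_opNorm₂ _ _

theorem LocNegligible.bilin_left (B : F₁ →L[ℝ] F₂ →L[ℝ] F₃) {u : Eps → E → F₁}
    {v : Eps → E → F₂} (hu : LocNegligible U u) (hv : LocModerate U v) :
    LocNegligible U (fun ε x => B (u ε x) (v ε x)) := fun K hK hc =>
  NegligibleOn.mul_le (hv.moderateOn hK hc) (hu K hK hc) ‖B‖ fun ε x _ => by
    rw [mul_comm ‖v ε x‖, ← mul_assoc]; exact B.le_opNorm₂ _ _

theorem LocModerate.fderiv {u : Eps → E → F} (hu : LocModerate U u) :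
    LocModerate U (fun ε => fderiv ℝ (u ε)) := fun K hK hc k =>
  (hu K hK hc (k + 1)).mono_le fun ε x _ => by rw [norm_iteratedFDeriv_fderiv]

end Local

section FirstDerivative

variable {E F : Type*} [NormedAddCommGroup E] [NormedSpace ℝ E] [ProperSpace E]
  [NormedAddCommGroup F] [NormedSpace ℝ F] {U : Set E}

/-- A moderate net of smooth functions that is negligible (without derivatives) has a negligible
net of first derivatives. -/
theorem LocNegligible.fderiv (hU : IsOpen U) {u : Eps → E → F}
    (hs : ∀ ε, ContDiffOn ℝ ∞ (u ε) U) (hm : LocModerate U u) (hn : LocNegligible U u) :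
    LocNegligible U (fun ε => fderiv ℝ (u ε)) := by
  intro K hK hc m
  obtain ⟨δ, hδ, hδU⟩ := hc.exists_cthickening_subset_open hU hK
  have hc' : IsCompact (Metric.cthickening δ K) := hc.cthickening
  obtain ⟨N, C, hC, h2⟩ := (hm _ hδU hc' 2).nonneg
  obtain ⟨A, hA⟩ := hn _ hδU hc' (2 * m + N)
  refine ⟨2 * |A| / δ + C * δ, ?_⟩
  filter_upwards [h2, hA] with ε h2 hA y hy
  have hε := ε.2.1
  have hε1 := ε.2.2
  obtain ⟨e, he⟩ : ∃ e : ℝ, e = (ε : ℝ) := ⟨_, rfl⟩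
  rw [← he] at h2 hA hε hε1 ⊢
  have hh : 0 < δ * e ^ (m + N) := by positivity
  obtain ⟨h, hh'⟩ : ∃ h : ℝ, h = δ * e ^ (m + N) := ⟨_, rfl⟩
  rw [← hh'] at hh
  have hhδ : h ≤ δ := by
    rw [hh']
    exact mul_le_of_le_one_right hδ.le (pow_le_one₀ hε.le hε1)
  have hball : Metric.closedBall y h ⊆ Metric.cthickening δ K :=
    (Metric.closedBall_subset_closedBall hhδ).trans (Metric.closedBall_subset_cthickening hy δ)
  have hat : ∀ x ∈ Metric.closedBall y h, ContDiffAt ℝ ∞ (u ε) x := fun x hx =>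
    (hs ε).contDiffAt (hU.mem_nhds (hδU (hball hx)))
  have hd : ∀ x ∈ Metric.closedBall y h, DifferentiableAt ℝ (u ε) x := fun x hx =>
    (hat x hx).differentiableAt (by simp)
  have hdd : ∀ x ∈ Metric.closedBall y h, DifferentiableAt ℝ (_root_.fderiv ℝ (u ε)) x :=
    fun x hx => ((hat x hx).fderiv_right (m := ∞) le_rfl).differentiableAt
      (by simp)
  have hconv : Convex ℝ (Metric.closedBall y h) := convex_closedBall y h
  have hy0 : y ∈ Metric.closedBall y h := Metric.mem_closedBall_self hh.le
  have hder : ∀ x ∈ Metric.closedBall y h,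
      ‖_root_.fderiv ℝ (u ε) x - _root_.fderiv ℝ (u ε) y‖ ≤ C * e⁻¹ ^ N * h := by
    intro x hx
    refine (hconv.norm_image_sub_le_of_norm_fderiv_le (f := _root_.fderiv ℝ (u ε))
      (C := C * e⁻¹ ^ N) hdd (fun z hz => ?_) hy0 hx).trans ?_
    · rw [← norm_iteratedFDeriv_one, norm_iteratedFDeriv_fderiv]
      exact h2 z (hball hz)
    · gcongr
      simpa [dist_eq_norm] using hx
  have hup : ∀ x ∈ Metric.closedBall y h, ‖u ε x‖ ≤ |A| * e ^ (2 * m + N) := fun x hx =>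
    (hA x (hball hx)).trans (by gcongr; exact le_abs_self A)
  have hw : ∀ w : E, ‖w‖ = h → ‖_root_.fderiv ℝ (u ε) y w‖ ≤
      2 * (|A| * e ^ (2 * m + N)) + C * e⁻¹ ^ N * h * h := by
    intro w hw
    have hmem : y + w ∈ Metric.closedBall y h := by simp [hw]
    have := hconv.norm_image_sub_le_of_norm_fderiv_le' (f := u ε)
      (φ := _root_.fderiv ℝ (u ε) y) hd hder hy0 hmem
    rw [add_sub_cancel_left, hw] at this
    have e1 : _root_.fderiv ℝ (u ε) y w =
        u ε (y + w) - u ε y - (u ε (y + w) - u ε y - _root_.fderiv ℝ (u ε) y w) := by abel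
    rw [e1]
    refine (norm_sub_le _ _).trans ((add_le_add ((norm_sub_le _ _).trans
      (add_le_add (hup _ hmem) (hup _ hy0))) this).trans (le_of_eq (by ring)))
  have hpow : e⁻¹ ^ N * e ^ N = 1 := by rw [← mul_pow, inv_mul_cancel₀ hε.ne', one_pow]
  have hval : 2 * (|A| * e ^ (2 * m + N)) + C * e⁻¹ ^ N * h * h =
      h * ((2 * |A| / δ + C * δ) * e ^ m) := by
    have e1 : C * e⁻¹ ^ N * h * h = h * (C * δ * e ^ m * (e⁻¹ ^ N * e ^ N)) := by
      rw [hh']; ring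
    have e2 : 2 * (|A| * e ^ (2 * m + N)) = h * (2 * |A| / δ * e ^ m) := by
      rw [hh']; field_simp; ring
    rw [e1, e2, hpow]; ring
  refine ContinuousLinearMap.opNorm_le_bound _ (by positivity) fun v => ?_
  rcases eq_or_ne v 0 with rfl | hv
  · simp
  have hv' : 0 < ‖v‖ := norm_pos_iff.2 hv
  have := hw ((h / ‖v‖) • v) (by
    rw [norm_smul, Real.norm_of_nonneg (by positivity), div_mul_cancel₀ _ hv'.ne'])
  rw [hval, map_smul, norm_smul, Real.norm_of_nonneg (by positivity), div_mul_eq_mul_div,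
    mul_div_assoc] at this
  have := le_of_mul_le_mul_left this hh
  rwa [div_le_iff₀ hv'] at this

end FirstDerivative

/-! ### Smooth sections in charts -/

section Sections

variable {E : Type*} [NormedAddCommGroup E] [NormedSpace ℝ E]
  {M : Type*} [TopologicalSpace M] [ChartedSpace E M]

variable (E M) in
/-- The ring `C^∞(M)`. -/
abbrev SmoothFun : Type _ := C^∞⟮𝓘(ℝ, E), M; ℝ⟯

variable {F : Type*} [NormedAddCommGroup F] [NormedSpace ℝ F]
  {V : M → Type*} [TopologicalSpace (TotalSpace F V)] [∀ x, AddCommGroup (V x)]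
  [∀ x, Module ℝ (V x)] [∀ x, TopologicalSpace (V x)] [FiberBundle F V]

variable (E F V) in
/-- The preferred local trivializations of the bundle live over the preferred chart domains. This
holds for all tensor bundles: their preferred trivializations are induced by the charts. -/
class ChartAdapted : Prop where
  source_subset : ∀ p : M, (chartAt E p).source ⊆ (trivializationAt F V p).baseSet

/-- The local representation `ψ_* s : ψ(W) → F` of a section `s` in the chart `(W, ψ)` around `p`
(only meaningful on `ψ(W) = (chartAt E p).target`). -/
def loc (E : Type*) [NormedAddCommGroup E] [ChartedSpace E M] (F : Type*) [NormedAddCommGroup F]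
    [NormedSpace ℝ F] {V : M → Type*} [TopologicalSpace (TotalSpace F V)]
    [∀ x, TopologicalSpace (V x)] [FiberBundle F V] (p : M) (s : ∀ x, V x) : E → F :=
  fun y => (trivializationAt F V p ⟨(chartAt E p).symm y, s ((chartAt E p).symm y)⟩).2

/-- The local representation `f ∘ ψ⁻¹` of a function. -/
def locFun (p : M) (f : M → ℝ) : E → ℝ := fun y => f ((chartAt E p).symm y)

theorem contDiffOn_locFun [IsManifold 𝓘(ℝ, E) ∞ M] (f : SmoothFun E M) (p : M) :
    ContDiffOn ℝ ∞ (locFun p f) (chartAt E p).target := by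
  have h1 : ContMDiffOn 𝓘(ℝ, E) 𝓘(ℝ, E) ∞ (chartAt E p).symm (chartAt E p).target :=
    contMDiffOn_chart_symm
  have h2 : ContMDiffOn 𝓘(ℝ, E) 𝓘(ℝ, ℝ) ∞ (fun y => f ((chartAt E p).symm y))
    (chartAt E p).target := f.contMDiff.comp_contMDiffOn h1
  exact contMDiffOn_iff_contDiffOn.1 h2

variable [VectorBundle ℝ F V]

theorem contDiffOn_loc [IsManifold 𝓘(ℝ, E) ∞ M] [ContMDiffVectorBundle ∞ F V 𝓘(ℝ, E)]
    [ChartAdapted E F V] (s : Cₛ^∞⟮𝓘(ℝ, E); F, V⟯) (p : M) :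
    ContDiffOn ℝ ∞ (loc E F p s) (chartAt E p).target := by
  rw [← contMDiffOn_iff_contDiffOn]
  have h1 := (trivializationAt F V p).contMDiffOn (IB := 𝓘(ℝ, E)) (n := ∞)
  have h2 : ContMDiffOn 𝓘(ℝ, E) (𝓘(ℝ, E).prod 𝓘(ℝ, F)) ∞
      (fun y => (⟨(chartAt E p).symm y, s ((chartAt E p).symm y)⟩ : TotalSpace F V))
      (chartAt E p).target := s.contMDiff.comp_contMDiffOn contMDiffOn_chart_symm
  have h3 := h1.comp h2 fun y hy => (trivializationAt F V p).mem_source.2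
    (ChartAdapted.source_subset p ((chartAt E p).map_target hy))
  exact contMDiff_snd.comp_contMDiffOn h3

/-- The `C^∞(M)`-module structure on `Γ(V)`. -/
instance sectionModule : Module (SmoothFun E M) Cₛ^∞⟮𝓘(ℝ, E); F, V⟯ where
  smul f s := ⟨fun x => f x • s x, f.contMDiff.smul_section s.contMDiff⟩
  one_smul s := by ext x; exact one_smul ℝ (s x)
  mul_smul f g s := by ext x; exact mul_smul (f x) (g x) (s x)
  smul_zero f := by ext x; exact smul_zero (f x)
  smul_add f s t := by ext x; exact smul_add (f x) (s x) (t x)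
  add_smul f g s := by ext x; exact add_smul (f x) (g x) (s x)
  zero_smul s := by ext x; exact zero_smul ℝ (s x)

theorem section_smul_apply (f : SmoothFun E M) (s : Cₛ^∞⟮𝓘(ℝ, E); F, V⟯) (x : M) :
    (f • s) x = f x • s x := rfl

variable [ChartAdapted E F V]

theorem mem_baseSet (F : Type*) [NormedAddCommGroup F] [NormedSpace ℝ F]
    (V : M → Type*) [TopologicalSpace (TotalSpace F V)]
    [∀ x, TopologicalSpace (V x)] [FiberBundle F V]
    [ChartAdapted E F V] {p : M} {y : E} (hy : y ∈ (chartAt E p).target) :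
    (chartAt E p).symm y ∈ (trivializationAt F V p).baseSet :=
  ChartAdapted.source_subset p ((chartAt E p).map_target hy)

theorem loc_add (s t : Cₛ^∞⟮𝓘(ℝ, E); F, V⟯) (p : M) :
    EqOn (loc E F p (s + t)) (fun y => loc E F p s y + loc E F p t y) (chartAt E p).target :=
  fun _ hy => ((trivializationAt F V p).linear ℝ (mem_baseSet F V hy)).map_add _ _

theorem loc_smul (f : SmoothFun E M) (s : ∀ x, V x) (p : M) :
    EqOn (loc E F p (fun x => f x • s x)) (fun y => locFun p f y • loc E F p s y)
      (chartAt E p).target :=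
  fun _ hy => ((trivializationAt F V p).linear ℝ (mem_baseSet F V hy)).map_smul _ _

theorem loc_zero (p : M) :
    EqOn (loc E F p (0 : Cₛ^∞⟮𝓘(ℝ, E); F, V⟯)) (fun _ => (0 : F)) (chartAt E p).target :=
  fun _ hy => ((trivializationAt F V p).linear ℝ (mem_baseSet F V hy)).map_zero

end Sections

/-! ### The Colombeau algebra and generalized sections -/

section Generalized

variable (E : Type*) [NormedAddCommGroup E] [NormedSpace ℝ E]
  (M : Type*) [TopologicalSpace M] [ChartedSpace E M] [IsManifold 𝓘(ℝ, E) ∞ M]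

/-- The ring `ℰ_M(M)` of moderate nets of smooth functions: in every chart, all derivatives are
`O(ε^{-N})` on compact sets, for some `N`. -/
def ModFun : Subring (Eps → SmoothFun E M) where
  carrier := {f | ∀ p : M, LocModerate (chartAt E p).target (fun ε => locFun p (f ε))}
  mul_mem' {f g} hf hg p :=
    (hf p).bilin (chartAt E p).open_target (ContinuousLinearMap.mul ℝ ℝ)
      (fun ε => contDiffOn_locFun (f ε) p) (fun ε => contDiffOn_locFun (g ε) p) (hg p)
  one_mem' _ := LocModerate.const (1 : ℝ)
  add_mem' {f g} hf hg p :=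
    (hf p).add (chartAt E p).open_target
      (fun ε => contDiffOn_locFun (f ε) p) (fun ε => contDiffOn_locFun (g ε) p) (hg p)
  zero_mem' _ := LocModerate.const (0 : ℝ)
  neg_mem' {f} hf p := by
    refine ((LocModerate.const (-1 : ℝ)).bilin (chartAt E p).open_target
      (ContinuousLinearMap.mul ℝ ℝ) (fun ε => contDiffOn_const)
      (fun ε => contDiffOn_locFun (f ε) p) (hf p)).congr (chartAt E p).open_target
      fun ε y _ => ?_
    simp [locFun]

/-- The ideal `𝒩(M)` of negligible nets. -/
def NegFun : Ideal (ModFun E M) where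
  carrier := {f | ∀ p : M, LocNegligible (chartAt E p).target (fun ε => locFun p (f.1 ε))}
  add_mem' {f g} hf hg p := (hf p).add (hg p)
  zero_mem' _ _ _ _ := negligibleOn_zero
  smul_mem' f g hg p := (hg p).bilin_right (ContinuousLinearMap.mul ℝ ℝ) (f.2 p)

/-- The Colombeau algebra `𝒢(M) = ℰ_M(M) / 𝒩(M)`. -/
def GenFun : Type _ := ModFun E M ⧸ NegFun E M

instance : CommRing (GenFun E M) := Ideal.Quotient.commRing (NegFun E M)

variable {E M} in
/-- The class `[(f_ε)]` in `𝒢(M)`. -/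
def GenFun.mk : ModFun E M →+* GenFun E M := Ideal.Quotient.mk (NegFun E M)

variable {M}
variable (F : Type*) [NormedAddCommGroup F] [NormedSpace ℝ F]
  (V : M → Type*) [TopologicalSpace (TotalSpace F V)] [∀ x, AddCommGroup (V x)]
  [∀ x, Module ℝ (V x)] [∀ x, TopologicalSpace (V x)] [FiberBundle F V] [VectorBundle ℝ F V]
  [ContMDiffVectorBundle ∞ F V 𝓘(ℝ, E)] [ChartAdapted E F V]

/-- The module `Γ_{ℰ_M}(V)` of moderate nets of smooth sections. -/
def ModSec : Submodule (ModFun E M) (Eps → Cₛ^∞⟮𝓘(ℝ, E); F, V⟯) where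
  carrier := {s | ∀ p : M, LocModerate (chartAt E p).target (fun ε => loc E F p (s ε))}
  add_mem' {s t} hs ht p :=
    ((hs p).add (chartAt E p).open_target (fun ε => contDiffOn_loc (s ε) p)
      (fun ε => contDiffOn_loc (t ε) p) (ht p)).congr (chartAt E p).open_target
      fun ε => loc_add (s ε) (t ε) p
  zero_mem' p := (LocModerate.const (0 : F)).congr (chartAt E p).open_target fun _ => loc_zero p
  smul_mem' f s hs p :=
    ((f.2 p).bilin (chartAt E p).open_target (ContinuousLinearMap.lsmul ℝ ℝ)
      (fun ε => contDiffOn_locFun (f.1 ε) p) (fun ε => contDiffOn_loc (s ε) p) (hs p)).congr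
      (chartAt E p).open_target fun ε => loc_smul (f.1 ε) (s ε) p

instance : AddCommGroup (ModSec E F V) := (ModSec E F V).addCommGroup

instance modSecModule : Module (ModFun E M) (ModSec E F V) := (ModSec E F V).module

instance : SMul (ModFun E M) (ModSec E F V) := (modSecModule E F V).toSMul

/-- The submodule `Γ_𝒩(V)` of negligible nets of sections. -/
def NegSec : Submodule (ModFun E M) (ModSec E F V) where
  carrier := {s | ∀ p : M, LocNegligible (chartAt E p).target (fun ε => loc E F p (s.1 ε))}
  add_mem' {s t} hs ht p := ((hs p).add (ht p)).congr fun ε => loc_add (s.1 ε) (t.1 ε) p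
  zero_mem' p := LocNegligible.congr (fun _ _ _ => negligibleOn_zero) fun _ => loc_zero p
  smul_mem' f s hs p :=
    ((hs p).bilin_right (ContinuousLinearMap.lsmul ℝ ℝ) (f.2 p)).congr
      fun ε => loc_smul (f.1 ε) (s.1 ε) p

/-- The space of generalized sections `Γ_𝒢(V) = Γ_{ℰ_M}(V) / Γ_𝒩(V)`. -/
def GenSec : Type _ := ModSec E F V ⧸ NegSec E F V

instance : AddCommGroup (GenSec E F V) := Submodule.Quotient.addCommGroup (NegSec E F V)

instance genSecModModule : Module (ModFun E M) (GenSec E F V) :=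
  Submodule.Quotient.module (NegSec E F V)

variable {E F V} in
/-- The class `[(s_ε)]` in `Γ_𝒢(V)`. -/
def GenSec.mk : ModSec E F V →ₗ[ModFun E M] GenSec E F V := (NegSec E F V).mkQ

theorem genSec_torsion : Module.IsTorsionBySet (ModFun E M) (GenSec E F V)
    (NegFun E M : Set (ModFun E M)) := by
  rintro s ⟨f, hf⟩
  obtain ⟨s, rfl⟩ := Submodule.Quotient.mk_surjective _ s
  refine (Submodule.Quotient.mk_eq_zero _).2 fun p => ?_
  exact ((hf p).bilin_left (ContinuousLinearMap.lsmul ℝ ℝ) (s.2 p)).congr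
      fun ε => loc_smul (f.1 ε) (s.1 ε) p

/-- The `𝒢(M)`-module structure `[(f_ε)] • [(s_ε)] = [(f_ε s_ε)]` on generalized sections. -/
instance genSecModule : Module (GenFun E M) (GenSec E F V) :=
  Module.IsTorsionBySet.module (I := NegFun E M) (genSec_torsion E F V)

instance : SMul (GenFun E M) (GenSec E F V) := (genSecModule E F V).toSMul

theorem genSec_mk_smul (f : ModFun E M) (s : ModSec E F V) :
    GenFun.mk f • GenSec.mk s = GenSec.mk (f • s) := rfl

end Generalized

/-! ### Fibrewise application -/

section Apply

variable {E : Type*} [NormedAddCommGroup E] [NormedSpace ℝ E]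
  {M : Type*} [TopologicalSpace M] [ChartedSpace E M] [IsManifold 𝓘(ℝ, E) ∞ M]
  {F₁ : Type*} [NormedAddCommGroup F₁] [NormedSpace ℝ F₁]
  {V₁ : M → Type*} [TopologicalSpace (TotalSpace F₁ V₁)] [∀ x, AddCommGroup (V₁ x)]
  [∀ x, Module ℝ (V₁ x)] [∀ x, TopologicalSpace (V₁ x)] [FiberBundle F₁ V₁] [VectorBundle ℝ F₁ V₁]
  {F₂ : Type*} [NormedAddCommGroup F₂] [NormedSpace ℝ F₂]
  {V₂ : M → Type*} [TopologicalSpace (TotalSpace F₂ V₂)] [∀ x, AddCommGroup (V₂ x)]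
  [∀ x, Module ℝ (V₂ x)] [∀ x, TopologicalSpace (V₂ x)] [FiberBundle F₂ V₂] [VectorBundle ℝ F₂ V₂]
  [∀ x, IsTopologicalAddGroup (V₂ x)] [∀ x, ContinuousSMul ℝ (V₂ x)]

instance [ChartAdapted E F₁ V₁] [ChartAdapted E F₂ V₂] :
    ChartAdapted E (F₁ →L[ℝ] F₂) (fun x => V₁ x →L[ℝ] V₂ x) :=
  ⟨fun p => subset_inter (ChartAdapted.source_subset p) (ChartAdapted.source_subset p)⟩

theorem loc_apply [ChartAdapted E F₁ V₁] [ChartAdapted E F₂ V₂] (φ : ∀ x, V₁ x →L[ℝ] V₂ x)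
    (s : ∀ x, V₁ x) (p : M) :
    EqOn (loc E F₂ p (fun x => φ x (s x)))
      (fun y => loc E (F₁ →L[ℝ] F₂) p φ y (loc E F₁ p s y)) (chartAt E p).target := by
  intro y hy
  have h1 := mem_baseSet F₁ V₁ hy
  have h2 := mem_baseSet F₂ V₂ hy
  simp only [loc, hom_trivializationAt_apply, ContinuousLinearMap.inCoordinates_eq h1 h2]
  simp [h1, h2]

variable [ContMDiffVectorBundle ∞ F₁ V₁ 𝓘(ℝ, E)] [ContMDiffVectorBundle ∞ F₂ V₂ 𝓘(ℝ, E)]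
  [ChartAdapted E F₁ V₁] [ChartAdapted E F₂ V₂]

/-- Apply a net of bundle homomorphisms to a net of sections. -/
def ModSec.apply (φ : ModSec E (F₁ →L[ℝ] F₂) (fun x => V₁ x →L[ℝ] V₂ x)) (s : ModSec E F₁ V₁) :
    ModSec E F₂ V₂ :=
  ⟨fun ε => ⟨fun x => φ.1 ε x (s.1 ε x), (φ.1 ε).contMDiff.clm_bundle_apply (s.1 ε).contMDiff⟩,
    fun p => ((φ.2 p).bilin (chartAt E p).open_target (ContinuousLinearMap.id ℝ (F₁ →L[ℝ] F₂))
      (fun ε => contDiffOn_loc (φ.1 ε) p) (fun ε => contDiffOn_loc (s.1 ε) p) (s.2 p)).congr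
      (chartAt E p).open_target fun ε => loc_apply (φ.1 ε) (s.1 ε) p⟩

theorem ModSec.apply_neg_left {φ : ModSec E (F₁ →L[ℝ] F₂) (fun x => V₁ x →L[ℝ] V₂ x)}
    (hφ : φ ∈ NegSec E (F₁ →L[ℝ] F₂) (fun x => V₁ x →L[ℝ] V₂ x)) (s : ModSec E F₁ V₁) :
    ModSec.apply φ s ∈ NegSec E F₂ V₂ := fun p =>
  ((hφ p).bilin_left (ContinuousLinearMap.id ℝ (F₁ →L[ℝ] F₂)) (s.2 p)).congr
    fun ε => loc_apply (φ.1 ε) (s.1 ε) p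

theorem ModSec.apply_neg_right (φ : ModSec E (F₁ →L[ℝ] F₂) (fun x => V₁ x →L[ℝ] V₂ x))
    {s : ModSec E F₁ V₁} (hs : s ∈ NegSec E F₁ V₁) :
    ModSec.apply φ s ∈ NegSec E F₂ V₂ := fun p =>
  ((hs p).bilin_right (ContinuousLinearMap.id ℝ (F₁ →L[ℝ] F₂)) (φ.2 p)).congr
    fun ε => loc_apply (φ.1 ε) (s.1 ε) p

theorem ModSec.apply_sub_apply (φ φ' : ModSec E (F₁ →L[ℝ] F₂) (fun x => V₁ x →L[ℝ] V₂ x))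
    (s s' : ModSec E F₁ V₁) : ModSec.apply φ s - ModSec.apply φ' s' =
      ModSec.apply (φ - φ') s + ModSec.apply φ' (s - s') := by
  refine Subtype.ext (funext fun ε => ContMDiffSection.ext fun x => ?_)
  change φ.1 ε x (s.1 ε x) - φ'.1 ε x (s'.1 ε x) =
    (φ.1 ε x - φ'.1 ε x) (s.1 ε x) + φ'.1 ε x (s.1 ε x - s'.1 ε x)
  rw [sub_apply, map_sub]
  abel

/-- `[(φ_ε)] [(s_ε)] = [(φ_ε s_ε)]`. -/
def GenSec.apply : GenSec E (F₁ →L[ℝ] F₂) (fun x => V₁ x →L[ℝ] V₂ x) → GenSec E F₁ V₁ →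
    GenSec E F₂ V₂ :=
  Quotient.map₂ ModSec.apply fun φ φ' hφ s s' hs => by
    refine (Submodule.quotientRel_def _).2 ?_
    rw [ModSec.apply_sub_apply]
    exact add_mem (ModSec.apply_neg_left ((Submodule.quotientRel_def _).1 hφ) s)
      (ModSec.apply_neg_right φ' ((Submodule.quotientRel_def _).1 hs))

theorem GenSec.apply_mk (φ : ModSec E (F₁ →L[ℝ] F₂) (fun x => V₁ x →L[ℝ] V₂ x))
    (s : ModSec E F₁ V₁) :
    GenSec.apply (GenSec.mk φ) (GenSec.mk s) = GenSec.mk (ModSec.apply φ s) := rfl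

end Apply

/-! ### Vector fields, one-forms and covariant two-tensors -/

section Tensors

variable (E : Type*) [NormedAddCommGroup E] [NormedSpace ℝ E]
  (M : Type*) [TopologicalSpace M] [ChartedSpace E M] [IsManifold 𝓘(ℝ, E) ∞ M]

/-- The tangent bundle `TM`. -/
abbrev Tan : M → Type _ := TangentSpace 𝓘(ℝ, E)

/-- The cotangent bundle `T*M`. -/
abbrev Cotan : M → Type _ := fun x => Tan E M x →L[ℝ] Bundle.Trivial M ℝ x

instance (x : M) : IsTopologicalAddGroup (Cotan E M x) :=
  ContinuousLinearMap.topologicalAddGroup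

instance (x : M) : ContinuousAdd (Cotan E M x) :=
  IsTopologicalAddGroup.toContinuousAdd

instance (x : M) : ContinuousSMul ℝ (Cotan E M x) :=
  ContinuousLinearMap.continuousSMul

/-- The bundle `T⁰₂M` of bilinear forms on the tangent spaces. -/
abbrev Bil : M → Type _ := fun x => Tan E M x →L[ℝ] (Tan E M x →L[ℝ] Bundle.Trivial M ℝ x)

instance : ChartAdapted E E (Tan E M) := ⟨fun _ => subset_rfl⟩

instance : ChartAdapted E ℝ (Bundle.Trivial M ℝ) := ⟨fun _ => subset_univ _⟩

instance : ContMDiffVectorBundle ∞ (E →L[ℝ] ℝ) (Cotan E M) 𝓘(ℝ, E) := inferInstance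

/-- Moderate nets of smooth covariant two-tensors. -/
abbrev ModBil : Type _ := ModSec E (E →L[ℝ] (E →L[ℝ] ℝ)) (Bil E M)

/-- Generalized vector fields `𝔛_𝒢(M) = Γ_𝒢(TM)`. -/
abbrev GenVF : Type _ := GenSec E E (Tan E M)

/-- Generalized one-forms `Ω¹_𝒢(M) = Γ_𝒢(T*M)`. -/
abbrev GenOneForm : Type _ := GenSec E (E →L[ℝ] ℝ) (Cotan E M)

/-- Generalized covariant two-tensors `𝒢⁰₂(M) = Γ_𝒢(T⁰₂M)`. -/
abbrev GenBil : Type _ := GenSec E (E →L[ℝ] (E →L[ℝ] ℝ)) (Bil E M)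

end Tensors

section Pairing

variable {E : Type*} [NormedAddCommGroup E] [NormedSpace ℝ E]
  {M : Type*} [TopologicalSpace M] [ChartedSpace E M] [IsManifold 𝓘(ℝ, E) ∞ M]

/-- Moderate sections of the trivial line bundle are moderate functions. -/
def ModSec.toModFun (s : ModSec E ℝ (Bundle.Trivial M ℝ)) : ModFun E M :=
  ⟨fun ε => ⟨fun x => s.1 ε x, fun x => (contMDiffAt_section x).1 ((s.1 ε).contMDiff x)⟩, s.2⟩

/-- Generalized sections of the trivial line bundle are generalized functions. -/
def GenSec.toGenFun : GenSec E ℝ (Bundle.Trivial M ℝ) → GenFun E M :=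
  Quotient.map ModSec.toModFun fun s t h => by
    refine (Submodule.quotientRel_def _).2 ?_
    exact (Submodule.quotientRel_def (NegSec E ℝ (Bundle.Trivial M ℝ))).1 h

/-- The evaluation `α(X) = [(α_ε(X_ε))] ∈ 𝒢(M)` of a one-form on a vector field. -/
def GenOneForm.eval (α : GenOneForm E M) (X : GenVF E M) : GenFun E M :=
  (GenSec.apply α X).toGenFun

/-- The evaluation `σ(X, Y) = [(σ_ε(X_ε, Y_ε))] ∈ 𝒢(M)` of a two-tensor on vector fields. -/
def GenBil.eval (σ : GenBil E M) (X Y : GenVF E M) : GenFun E M :=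
  (GenSec.apply (GenSec.apply σ X) Y).toGenFun
end Pairing

/-! ### The exterior derivative of generalized functions -/

section Differential

variable {E : Type*} [NormedAddCommGroup E] [NormedSpace ℝ E]
  {M : Type*} [TopologicalSpace M] [ChartedSpace E M] [IsManifold 𝓘(ℝ, E) ∞ M]

theorem loc_mvfderiv (f : SmoothFun E M) (p : M) :
    EqOn (loc E (E →L[ℝ] ℝ) p (V := Cotan E M) (fun x => mvfderiv 𝓘(ℝ, E) f x))
      (fderiv ℝ (locFun p f)) (chartAt E p).target := by
  intro y hy
  have hx := (chartAt E p).map_target hy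
  have h1 : (chartAt E p).symm y ∈ (trivializationAt E (Tan E M) p).baseSet := mem_baseSet E _ hy
  have h2 : (chartAt E p).symm y ∈ (trivializationAt ℝ (Bundle.Trivial M ℝ) p).baseSet :=
    mem_univ _
  have hs : MDifferentiableAt 𝓘(ℝ, E) 𝓘(ℝ, E) (chartAt E p).symm y :=
    (contMDiffOn_chart_symm (I := 𝓘(ℝ, E)) (n := ∞) |>.contMDiffAt
      ((chartAt E p).open_target.mem_nhds hy)).mdifferentiableAt (by simp)
  have hf : MDifferentiableAt 𝓘(ℝ, E) 𝓘(ℝ, ℝ) f ((chartAt E p).symm y) :=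
    f.contMDiff.mdifferentiableAt (by simp)
  have key : mfderiv 𝓘(ℝ, E) 𝓘(ℝ, ℝ) (f ∘ (chartAt E p).symm) y = _ := mfderiv_comp y hf hs
  simp only [loc, hom_trivializationAt_apply, ContinuousLinearMap.inCoordinates]
  have e0 := Bundle.Trivial.continuousLinearMapAt_trivialization ℝ M ℝ ((chartAt E p).symm y)
  have e1 := TangentBundle.symmL_trivializationAt (I := 𝓘(ℝ, E)) hx
  simp only [modelWithCornersSelf_coe, range_id, mfderivWithin_univ, extChartAt, mfld_simps,
    OpenPartialHomeomorph.extend] at e1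
  ext v
  have e3 : (trivializationAt E (Tan E M) p).symmL ℝ ((chartAt E p).symm y) v =
      mfderiv 𝓘(ℝ, E) 𝓘(ℝ, E) (chartAt E p).symm y v :=
    (congrArg (fun L => L v) e1).trans
      (congrArg (fun z => (mfderiv 𝓘(ℝ, E) 𝓘(ℝ, E) (chartAt E p).symm z : E → E) v)
        ((chartAt E p).right_inv hy))
  have e4 : fderiv ℝ (locFun p f) y v = mfderiv 𝓘(ℝ, E) 𝓘(ℝ, ℝ) f ((chartAt E p).symm y)
      (mfderiv 𝓘(ℝ, E) 𝓘(ℝ, E) (chartAt E p).symm y v) :=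
    (congrArg (fun L : E →L[ℝ] ℝ => L v) (mfderiv_eq_fderiv (f := f ∘ (chartAt E p).symm)
      (x := y))).symm.trans (congrArg (fun L : E →L[ℝ] ℝ => L v) key)
  rw [e4, ← e3]
  change (trivializationAt ℝ (Bundle.Trivial M ℝ) p).continuousLinearMapAt ℝ _ (mvfderiv 𝓘(ℝ, E) f _ _) = _
  exact congrArg (fun L : ℝ →L[ℝ] ℝ => L (mvfderiv 𝓘(ℝ, E) f _ _)) e0

/-- The differential `df` of a smooth function. -/
def dSmooth (f : SmoothFun E M) : Cₛ^∞⟮𝓘(ℝ, E); E →L[ℝ] ℝ, Cotan E M⟯ :=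
  ⟨fun x => mvfderiv 𝓘(ℝ, E) f x, fun p => by
    rw [contMDiffAt_section]
    have h1 : ContMDiffAt 𝓘(ℝ, E) 𝓘(ℝ, E →L[ℝ] ℝ) ∞
        (fun x => fderiv ℝ (locFun p f) (chartAt E p x)) p := by
      have h2 : ContDiffAt ℝ ∞ (fderiv ℝ (locFun p f)) (chartAt E p p) :=
        ((contDiffOn_locFun f p).contDiffAt
          ((chartAt E p).open_target.mem_nhds (mem_chart_target E p))).fderiv_right le_rfl
      exact h2.contMDiffAt.comp p
        ((contMDiffOn_chart (I := 𝓘(ℝ, E))).contMDiffAt (chart_source_mem_nhds E p))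
    refine h1.congr_of_eventuallyEq ?_
    filter_upwards [chart_source_mem_nhds E p] with x hx
    have := loc_mvfderiv f p ((chartAt E p).map_source hx)
    rw [← this, loc, (chartAt E p).left_inv hx]⟩

theorem dSmooth_apply (f : SmoothFun E M) (x : M) : dSmooth f x = mvfderiv 𝓘(ℝ, E) f x := rfl

/-- The net `(df_ε)`. -/
def ModFun.d (f : ModFun E M) : ModSec E (E →L[ℝ] ℝ) (Cotan E M) :=
  ⟨fun ε => dSmooth (f.1 ε), fun p => (f.2 p).fderiv.congr (chartAt E p).open_target
    fun ε => loc_mvfderiv (f.1 ε) p⟩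

/-- The exterior derivative `d : 𝒢(M) → Ω¹_𝒢(M)`, `d[(f_ε)] = [(df_ε)]`. -/
def GenFun.d [ProperSpace E] : GenFun E M → GenOneForm E M :=
  Quotient.map ModFun.d fun f g h => by
    refine (Submodule.quotientRel_def _).2 fun p => ?_
    have h1 : f - g ∈ NegFun E M := (Submodule.quotientRel_def (NegFun E M)).1 h
    have h2 := LocNegligible.fderiv (chartAt E p).open_target
      (fun ε => contDiffOn_locFun ((f - g).1 ε) p) ((f - g).2 p) (h1 p)
    refine h2.congr fun ε y hy => ?_
    have e1 := loc_add (dSmooth (f.1 ε) - dSmooth (g.1 ε)) (dSmooth (g.1 ε)) p hy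
    rw [sub_add_cancel] at e1
    have d1 := ((contDiffOn_locFun (f.1 ε) p).contDiffAt
      ((chartAt E p).open_target.mem_nhds hy)).differentiableAt (by simp)
    have d2 := ((contDiffOn_locFun (g.1 ε) p).contDiffAt
      ((chartAt E p).open_target.mem_nhds hy)).differentiableAt (by simp)
    have e2 : fderiv ℝ (locFun p ((f - g).1 ε)) y =
        fderiv ℝ (locFun p (f.1 ε)) y - fderiv ℝ (locFun p (g.1 ε)) y := fderiv_sub d1 d2
    rw [e2, ← loc_mvfderiv (f.1 ε) p hy, ← loc_mvfderiv (g.1 ε) p hy]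
    exact (sub_eq_of_eq_add e1).symm

end Differential

/-! ### Generalized numbers and point values -/

section Numbers

/-- The ring of moderate nets of real numbers, `|r_ε| = O(ε^{-N})` for some `N`. -/
def ModNum : Subring (Eps → ℝ) where
  carrier := {r | ModerateOn (univ : Set Unit) (fun ε _ => r ε)}
  mul_mem' hr hs := hr.mul_le hs 1 fun ε _ _ => by simp
  one_mem' := moderateOn_bound 1 (by simp)
  add_mem' hr hs := hr.add hs
  zero_mem' := moderateOn_bound 0 (by simp)
  neg_mem' hr := hr.mono_le (by simp)

/-- The ideal of negligible nets of real numbers, `|r_ε| = O(ε^m)` for all `m`. -/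
def NegNum : Ideal ModNum where
  carrier := {r | NegligibleOn (univ : Set Unit) (fun ε _ => r.1 ε)}
  add_mem' hr hs := hr.add hs
  zero_mem' := negligibleOn_zero
  smul_mem' r _ hs := NegligibleOn.mul_le r.2 hs 1 fun ε _ _ => by simp

/-- The ring of generalized numbers `ℝ̃`. -/
def GenReal : Type := ModNum ⧸ NegNum

instance : CommRing GenReal := Ideal.Quotient.commRing NegNum

/-- The class `[(r_ε)]` in `ℝ̃`. -/
def GenReal.mk : ModNum →+* GenReal := Ideal.Quotient.mk NegNum

/-- Nets of points of `U` that stay in a fixed compact subset of `U` for small `ε`. They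
represent the compactly supported generalized points of `U`. -/
structure CompactNet {E : Type*} [TopologicalSpace E] (U : Set E) where
  /-- the underlying net -/
  toFun : Eps → E
  exists_compact : ∃ K ⊆ U, IsCompact K ∧ ∀ᶠ ε in epsZero, toFun ε ∈ K

end Numbers

section PointValues

variable {E : Type*} [NormedAddCommGroup E] [NormedSpace ℝ E]
  {M : Type*} [TopologicalSpace M] [ChartedSpace E M] [IsManifold 𝓘(ℝ, E) ∞ M]

/-- The moderate net of numbers `(ψ_* σ_ε)(z_ε)(a, b)`, in the chart `ψ` around `p`. -/
def ModBil.pointValue (p : M) (z : CompactNet (chartAt E p).target) (a b : E)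
    (s : ModBil E M) : ModNum :=
  ⟨fun ε => loc E (E →L[ℝ] (E →L[ℝ] ℝ)) p (s.1 ε) (z.toFun ε) a b, by
    obtain ⟨K, hK, hc, hz⟩ := z.exists_compact
    obtain ⟨N, C, h⟩ := (s.2 p).moderateOn hK hc
    refine ⟨N, C * (‖a‖ * ‖b‖), ?_⟩
    filter_upwards [h, hz] with ε h hz _ _
    refine (ContinuousLinearMap.le_opNorm₂ _ _ _).trans ?_
    have := mul_le_mul_of_nonneg_right (h _ hz) (mul_nonneg (norm_nonneg a) (norm_nonneg b))
    calc _ = _ := mul_assoc _ _ _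
      _ ≤ _ := this
      _ = _ := by ring⟩

/-- The generalized number `(ψ_* σ)(z̃)(a, b)`, in the chart `ψ` around `p`, at the compactly
supported generalized point `z̃ = [(z_ε)]`, for vectors `a, b`. -/
def GenBil.pointValue (σ : GenBil E M) (p : M) (z : CompactNet (chartAt E p).target)
    (a b : E) : GenReal :=
  Quotient.map (ModBil.pointValue p z a b) (fun s t h => by
    refine (Submodule.quotientRel_def NegNum).2 fun m => ?_
    have h1 := (Submodule.quotientRel_def
      (NegSec E (E →L[ℝ] (E →L[ℝ] ℝ)) (Bil E M))).1 h
    obtain ⟨K, hK, hc, hz⟩ := z.exists_compact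
    obtain ⟨C, h2⟩ := h1 p K hK hc m
    refine ⟨C * (‖a‖ * ‖b‖), ?_⟩
    filter_upwards [h2, hz] with ε h2 hz _ _
    have e1 := loc_add ((s - t).1 ε) (t.1 ε) p (hK hz)
    have e2 : (s - t).1 ε + t.1 ε = s.1 ε := sub_add_cancel (s.1 ε) (t.1 ε)
    rw [e2] at e1
    have e3 := congrArg (fun L : E →L[ℝ] (E →L[ℝ] ℝ) => L a b) e1
    have e4 : loc E (E →L[ℝ] (E →L[ℝ] ℝ)) p (s.1 ε) (z.toFun ε) a b -
        loc E (E →L[ℝ] (E →L[ℝ] ℝ)) p (t.1 ε) (z.toFun ε) a b =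
        loc E (E →L[ℝ] (E →L[ℝ] ℝ)) p ((s - t).1 ε) (z.toFun ε) a b :=
      sub_eq_of_eq_add e3
    change ‖loc E (E →L[ℝ] (E →L[ℝ] ℝ)) p (s.1 ε) (z.toFun ε) a b -
        loc E (E →L[ℝ] (E →L[ℝ] ℝ)) p (t.1 ε) (z.toFun ε) a b‖ ≤ _
    rw [e4]
    refine (ContinuousLinearMap.le_opNorm₂ _ _ _).trans ?_
    have := mul_le_mul_of_nonneg_right (h2 _ hz) (mul_nonneg (norm_nonneg a) (norm_nonneg b))
    calc _ = _ := mul_assoc _ _ _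
      _ ≤ _ := this
      _ = _ := by ring) σ

/-- `σ` is non-degenerate: in every chart `(W, ψ)` and for every compactly supported generalized
point `z̃` of `ψ(W)`, the bilinear form `ψ_* σ(z̃)` on `ℝ̃ᵈ` is non-degenerate. -/
def GenBil.Nondegenerate {d : ℕ} {M : Type*} [TopologicalSpace M]
    [ChartedSpace (EuclideanSpace ℝ (Fin d)) M] [IsManifold (𝓡 d) ∞ M] (σ : GenBil (EuclideanSpace ℝ (Fin d)) M) : Prop :=
  ∀ (p : M) (z : CompactNet (chartAt (EuclideanSpace ℝ (Fin d)) p).target) (v : Fin d → GenReal),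
    (∀ w : Fin d → GenReal, ∑ i, ∑ j,
      σ.pointValue p z (EuclideanSpace.single i 1) (EuclideanSpace.single j 1) * v i * w j = 0) → v = 0

end PointValues

/-! ### Generalized symplectic forms -/

section Symplectic

variable {E : Type*} [NormedAddCommGroup E] [NormedSpace ℝ E]
  {M : Type*} [TopologicalSpace M] [ChartedSpace E M] [IsManifold 𝓘(ℝ, E) ∞ M]

/-- The coordinate expression, in the chart around `p`, of the exterior derivative `ds(u, v, w)` of
a smooth two-form `s`. -/
def dTwoForm (s : Cₛ^∞⟮𝓘(ℝ, E); E →L[ℝ] (E →L[ℝ] ℝ), Bil E M⟯) (p : M) (u v w : E) (y : E) : ℝ :=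
  fderiv ℝ (loc E (E →L[ℝ] (E →L[ℝ] ℝ)) p s) y u v w +
    fderiv ℝ (loc E (E →L[ℝ] (E →L[ℝ] ℝ)) p s) y v w u +
    fderiv ℝ (loc E (E →L[ℝ] (E →L[ℝ] ℝ)) p s) y w u v

/-- `σ` is a closed generalized two-form: it is the class of a moderate net of alternating forms
`σ_ε` such that `(dσ_ε)` is negligible. -/
def GenBil.IsClosedTwoForm (σ : GenBil E M) : Prop :=
  ∃ s : ModBil E M, GenSec.mk s = σ ∧
    (∀ ε (x : M) (v : Tan E M x), s.1 ε x v v = 0) ∧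
    ∀ (p : M) (u v w : E),
      LocNegligible (chartAt E p).target (fun ε => dTwoForm (s.1 ε) p u v w)

/-- The map `σ_♭`, `X ↦ σ(X, ·) = [(σ_ε(X_ε, ·))]`. -/
def GenBil.flat (σ : GenBil E M) (X : GenVF E M) : GenOneForm E M := GenSec.apply σ X

/-- The map `σ^♯`, the inverse of `σ_♭` (when `σ_♭` is bijective). -/
def GenBil.sharp (σ : GenBil E M) : GenOneForm E M → GenVF E M := Function.invFun σ.flat

/-- The Hamiltonian vector field `H_f = σ^♯(df)`. -/
def GenBil.hamiltonian [ProperSpace E] (σ : GenBil E M) (f : GenFun E M) : GenVF E M :=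
  σ.sharp f.d

/-- The Poisson bracket `{f, g} = σ(H_f, H_g)`. -/
def GenBil.poisson [ProperSpace E] (σ : GenBil E M) (f g : GenFun E M) : GenFun E M :=
  σ.eval (σ.hamiltonian f) (σ.hamiltonian g)

end Symplectic

/-- `σ` is a generalized symplectic form on the `d`-dimensional manifold `M`. -/
structure IsGenSymplectic {d : ℕ} {M : Type*} [TopologicalSpace M]
    [ChartedSpace (EuclideanSpace ℝ (Fin d)) M] [IsManifold (𝓡 d) ∞ M]
    (σ : GenBil (EuclideanSpace ℝ (Fin d)) M) : Prop where
  closed : σ.IsClosedTwoForm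
  nondegenerate : σ.Nondegenerate

end Colombeau

end

/-!
# Musical isomorphisms of a generalized symplectic form

Write `S_ε` for the coordinate expression of a representative of `σ`, viewed as a net of linear maps
from vectors to covectors.

Non-degeneracy at all compactly supported generalized points is a uniform statement: on a compact
subset `K` of a chart there is `N` with `ε ^ N * ‖v‖ ≤ ‖S_ε(y) v‖` for small `ε`, all `y ∈ K` and
all `v` (`GenBil.Nondegenerate.belowOn`). Otherwise, points and unit vectors that violate the bound
along a sequence `ε → 0` make up a generalized point and a non-zero generalized vector in the
kernel of the form at that point.

The lower bound gives injectivity of `σ_♭` at once, as negligibility does not involve derivatives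
(`ModBil.LocBelow.flat_injective`). For surjectivity, each `σ_ε` is injective on a given compact set
only for small `ε`, so that `σ_ε(X_ε, ·) = α_ε` need not be solvable on all of `M`. It is solved,
with a partition of unity, on the part of a compact exhaustion where `σ_ε` is injective, and this part
absorbs every compact set as `ε → 0` (`ModBil.LocBelow.exists_solution`). Moderateness of the
solution follows from that of `S_ε` and `α_ε` by induction on the order of the derivative: the
derivatives of the solution solve equations of the same kind
(`BelowOn.moderateOn_iteratedFDeriv`). No change of charts is needed in this argument.

Finally, a generalized one-form is determined by its values on vector fields, because coordinate
fields of a chart extend from compact sets to global smooth vector fields (`GenOneForm.ext_eval`).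
The statements on Hamiltonian vector fields and the Poisson bracket follow from bijectivity.
-/

noncomputable section

namespace Colombeau

/-! ### Nets of linear maps that are bounded below -/

section Below

universe u

variable {E F₁ F₂ F₃ : Type u} [NormedAddCommGroup E] [NormedSpace ℝ E]
  [NormedAddCommGroup F₁] [NormedSpace ℝ F₁]
  [NormedAddCommGroup F₂] [NormedSpace ℝ F₂] [NormedAddCommGroup F₃] [NormedSpace ℝ F₃]
  {U K : Set E}

/-- The linear maps `S_ε(y)` are bounded below by a power of `ε`, uniformly for `y ∈ K`. -/
def BelowOn {X : Type*} (K : Set X) (S : Eps → X → F₁ →L[ℝ] F₂) : Prop :=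
  ∃ N : ℕ, ∀ᶠ ε : Eps in epsZero, ∀ y ∈ K, ∀ v, (ε : ℝ) ^ N * ‖v‖ ≤ ‖S ε y v‖

theorem ModerateOn.congr_eventually {X F : Type*} [Norm F] {K : Set X} {u w : Eps → X → F}
    (hu : ModerateOn K u) (h : ∀ᶠ ε in epsZero, ∀ x ∈ K, w ε x = u ε x) : ModerateOn K w := by
  obtain ⟨N, C, h1⟩ := hu
  refine ⟨N, C, ?_⟩
  filter_upwards [h1, h] with ε h1 h x hx
  rw [h x hx]
  exact h1 x hx

theorem BelowOn.moderateOn {X : Type*} {K : Set X} {S : Eps → X → F₁ →L[ℝ] F₂}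
    (hS : BelowOn K S) {u : Eps → X → F₁} (hu : ModerateOn K (fun ε y => S ε y (u ε y))) :
    ModerateOn K u := by
  obtain ⟨N, hN⟩ := hS
  obtain ⟨N', C, h⟩ := hu
  refine ⟨N + N', C, ?_⟩
  filter_upwards [hN, h] with ε hN h y hy
  have hε := ε.2.1
  have h1 := (hN y hy _).trans (h y hy)
  rw [pow_add, mul_left_comm, inv_pow (ε : ℝ) N]
  exact (le_inv_mul_iff₀ (by positivity)).2 h1

theorem BelowOn.negligibleOn {X : Type*} {K : Set X} {S : Eps → X → F₁ →L[ℝ] F₂}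
    (hS : BelowOn K S) {u : Eps → X → F₁} (hu : NegligibleOn K (fun ε y => S ε y (u ε y))) :
    NegligibleOn K u := by
  obtain ⟨N, hN⟩ := hS
  intro m
  obtain ⟨C, h⟩ := hu (N + m)
  refine ⟨C, ?_⟩
  filter_upwards [hN, h] with ε hN h y hy
  have hε := ε.2.1
  have h1 := (hN y hy _).trans (h y hy)
  rw [pow_add, mul_left_comm] at h1
  exact le_of_mul_le_mul_left h1 (by positivity)

/-- Postcomposition with maps that are bounded below is bounded below. -/
theorem BelowOn.precompR {X : Type*} {K : Set X} {B : F₁ →L[ℝ] F₂ →L[ℝ] F₃} {S : Eps → X → F₁}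
    (hS : BelowOn K (fun ε y => B (S ε y))) : BelowOn K (fun ε y => B.precompR E (S ε y)) := by
  obtain ⟨N, hN⟩ := hS
  refine ⟨N, ?_⟩
  filter_upwards [hN] with ε hN y hy L
  have hε := ε.2.1
  rw [← le_inv_mul_iff₀ (by positivity)]
  refine ContinuousLinearMap.opNorm_le_bound _ (by positivity) fun v => ?_
  rw [mul_assoc, le_inv_mul_iff₀ (by positivity)]
  exact (hN y hy _).trans ((B.precompR E (S ε y) L).le_opNorm v)

/-- The Leibniz rule at a fixed order of differentiation. -/
theorem ModerateOn.iteratedFDeriv_bilin (hU : IsOpen U) (hK : K ⊆ U)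
    (B : F₁ →L[ℝ] F₂ →L[ℝ] F₃) {u : Eps → E → F₁} {v : Eps → E → F₂}
    (hus : ∀ ε, ContDiffOn ℝ ∞ (u ε) U) (hvs : ∀ ε, ContDiffOn ℝ ∞ (v ε) U) {k : ℕ}
    (hu : ∀ i ≤ k, ModerateOn K (fun ε => iteratedFDeriv ℝ i (u ε)))
    (hv : ∀ i ≤ k, ModerateOn K (fun ε => iteratedFDeriv ℝ i (v ε))) :
    ModerateOn K (fun ε => iteratedFDeriv ℝ k (fun x => B (u ε x) (v ε x))) := by
  have key : ModerateOn K (fun ε x => ∑ i ∈ Finset.range (k + 1),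
      ‖B‖ * ((k.choose i : ℝ) * ‖iteratedFDeriv ℝ i (u ε) x‖ *
        ‖iteratedFDeriv ℝ (k - i) (v ε) x‖)) := by
    refine ModerateOn.sum _ fun i hi => ?_
    refine (hu i (Finset.mem_range_succ_iff.1 hi)).mul_le (hv (k - i) (k.sub_le i))
      (‖B‖ * k.choose i) fun ε x _ => ?_
    rw [Real.norm_of_nonneg (by positivity)]
    apply le_of_eq
    ring
  refine key.mono_le fun ε x hx => ?_
  rw [Real.norm_of_nonneg (by positivity), ← Finset.mul_sum]
  have := B.norm_iteratedFDerivWithin_le_of_bilinear (hus ε) (hvs ε) hU.uniqueDiffOn (hK hx)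
    (n := k) (by exact_mod_cast le_top)
  rw [iteratedFDerivWithin_of_isOpen k hU (hK hx)] at this
  refine this.trans (le_of_eq ?_)
  congr 1
  refine Finset.sum_congr rfl fun i _ => ?_
  rw [iteratedFDerivWithin_of_isOpen i hU (hK hx),
    iteratedFDerivWithin_of_isOpen (k - i) hU (hK hx)]

theorem contDiffOn_fderiv {F : Type*} [NormedAddCommGroup F] [NormedSpace ℝ F]
    (hU : IsOpen U) {f : E → F} (hf : ContDiffOn ℝ ∞ f U) :
    ContDiffOn ℝ ∞ (fderiv ℝ f) U :=
  hf.fderiv_of_isOpen hU le_rfl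

theorem contDiffOn_bilin (B : F₁ →L[ℝ] F₂ →L[ℝ] F₃) {u : E → F₁} {v : E → F₂}
    (hu : ContDiffOn ℝ ∞ u U) (hv : ContDiffOn ℝ ∞ v U) :
    ContDiffOn ℝ ∞ (fun y => B (u y) (v y)) U :=
  (B.contDiff.comp_contDiffOn hu).clm_apply hv

/-- If the maps `B(S_ε, ·)` are bounded below, then moderateness of `S_ε` and of `B(S_ε, u_ε)`
implies moderateness of `u_ε`: differentiate `B(S_ε, u_ε)` and solve for the derivative of `u_ε`, on
which `B(S_ε, ·)` acts by postcomposition. -/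
theorem BelowOn.moderateOn_iteratedFDeriv (hU : IsOpen U) (hK : K ⊆ U) {S : Eps → E → F₁}
    (hSs : ∀ ε, ContDiffOn ℝ ∞ (S ε) U) (hSm : ∀ i, ModerateOn K fun ε => iteratedFDeriv ℝ i (S ε))
    (k : ℕ) :
    ∀ {F₂ F₃ : Type u} [NormedAddCommGroup F₂] [NormedSpace ℝ F₂] [NormedAddCommGroup F₃]
      [NormedSpace ℝ F₃] {B : F₁ →L[ℝ] F₂ →L[ℝ] F₃} {u : Eps → E → F₂},
      BelowOn K (fun ε y => B (S ε y)) → (∀ ε, ContDiffOn ℝ ∞ (u ε) U) →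
      (∀ i ≤ k, ModerateOn K (fun ε => iteratedFDeriv ℝ i (fun y => B (S ε y) (u ε y)))) →
      ModerateOn K (fun ε => iteratedFDeriv ℝ k (u ε)) := by
  induction k using Nat.strong_induction_on with
  | _ k ih =>
  intro F₂ F₃ _ _ _ _ B u hS hus hSu
  rcases k with _ | k
  · have h0 : ModerateOn K (fun ε y => B (S ε y) (u ε y)) :=
      (hSu 0 le_rfl).mono_le fun ε x _ => by simp
    exact (hS.moderateOn h0).mono_le fun ε x _ => by simp
  have hu : ∀ i ≤ k, ModerateOn K (fun ε => iteratedFDeriv ℝ i (u ε)) := fun i hi =>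
    ih i (by omega) hS hus fun j hj => hSu j (by omega)
  have hnhds : ∀ x ∈ K, U ∈ 𝓝 x := fun x hx => hU.mem_nhds (hK hx)
  have hSus : ∀ ε, ContDiffOn ℝ ∞ (fun y => B (S ε y) (u ε y)) U := fun ε =>
    contDiffOn_bilin B (hSs ε) (hus ε)
  -- the product rule, solved for the term that contains the derivative of `u_ε`
  have hfd : ∀ ε, EqOn (fun y => B.precompR E (S ε y) (fderiv ℝ (u ε) y))
      (fun y => fderiv ℝ (fun y => B (S ε y) (u ε y)) y -
        B.precompL E (fderiv ℝ (S ε) y) (u ε y)) U := by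
    intro ε y hy
    have h1 := (((hSs ε).contDiffAt (hU.mem_nhds hy)).differentiableAt (by simp)).hasFDerivAt
    have h2 := (((hus ε).contDiffAt (hU.mem_nhds hy)).differentiableAt (by simp)).hasFDerivAt
    have h3 : fderiv ℝ (fun y => B (S ε y) (u ε y)) y = _ :=
      (B.hasFDerivAt_of_bilinear h1 h2).fderiv
    change _ = fderiv ℝ (fun y => B (S ε y) (u ε y)) y - _
    rw [h3]
    exact (add_sub_cancel_right _ _).symm
  refine (ih k (by omega) (B := B.precompR E) (u := fun ε => fderiv ℝ (u ε)) hS.precompR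
    (fun ε => contDiffOn_fderiv hU (hus ε)) fun i hi => ?_).mono_le
    fun ε x _ => by rw [norm_iteratedFDeriv_fderiv]
  have hΦs : ∀ ε, ContDiffOn ℝ ∞ (fun y => B.precompL E (fderiv ℝ (S ε) y) (u ε y)) U := fun ε =>
    contDiffOn_bilin (B.precompL E) (contDiffOn_fderiv hU (hSs ε)) (hus ε)
  have h1 : ModerateOn K
      (fun ε => iteratedFDeriv ℝ i (fderiv ℝ (fun y => B (S ε y) (u ε y)))) :=
    (hSu (i + 1) (by omega)).mono_le fun ε x _ => by rw [norm_iteratedFDeriv_fderiv]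
  have h2 : ModerateOn K
      (fun ε => iteratedFDeriv ℝ i (fun y => B.precompL E (fderiv ℝ (S ε) y) (u ε y))) :=
    ModerateOn.iteratedFDeriv_bilin hU hK (B.precompL E)
      (fun ε => contDiffOn_fderiv hU (hSs ε)) hus
      (fun j _ => (hSm (j + 1)).mono_le fun ε x _ => by rw [norm_iteratedFDeriv_fderiv])
      fun j hj => hu j (by omega)
  have h3 : ModerateOn K
      (fun ε x => -iteratedFDeriv ℝ i (fun y => B.precompL E (fderiv ℝ (S ε) y) (u ε y)) x) :=
    h2.mono_le fun ε x _ => by rw [norm_neg]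
  refine (h1.add h3).congr fun ε x hx => ?_
  have hloc := (((hfd ε).eventuallyEq_of_mem (hnhds x hx)).iteratedFDeriv ℝ i).eq_of_nhds
  refine hloc.trans ?_
  rw [← sub_eq_add_neg]
  exact iteratedFDeriv_sub_apply
    (((contDiffOn_fderiv hU (hSus ε)).contDiffAt (hnhds x hx)).of_le (by exact_mod_cast le_top))
    (((hΦs ε).contDiffAt (hnhds x hx)).of_le (by exact_mod_cast le_top))

end Below

/-! ### Nets and sequences -/

section Sequences

theorem eventually_lt {δ : ℝ} (hδ : 0 < δ) : ∀ᶠ ε : Eps in epsZero, (ε : ℝ) < δ :=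
  tendsto_comap.eventually (gt_mem_nhds hδ)

theorem eventually_ne (e : Eps) : ∀ᶠ ε : Eps in epsZero, ε ≠ e :=
  (eventually_lt e.2.1).mono fun _ h he => h.ne (congrArg _ he)

/-- Along any sequence in `]0,1]`, the indices of parameters `ε` tend to infinity as `ε → 0`. This
allows data given along a sequence to be extended to nets. -/
theorem eventually_le_index (e : ℕ → Eps) (m : ℕ) :
    ∀ᶠ ε in epsZero, ∀ n, e n = ε → m ≤ n := by
  have h : ∀ᶠ ε in epsZero, ∀ n ∈ Finset.range m, ε ≠ e n :=
    (Filter.eventually_all_finset _).2 fun n _ => eventually_ne (e n)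
  filter_upwards [h] with ε h n hn
  by_contra hm
  exact h n (Finset.mem_range.2 (not_le.1 hm)) hn.symm

end Sequences

/-! ### Non-degeneracy yields uniform lower bounds -/

section Nondegenerate

variable {d : ℕ} {M : Type*} [TopologicalSpace M] [ChartedSpace (EuclideanSpace ℝ (Fin d)) M]
  [IsManifold (𝓡 d) ∞ M]

/-- If `s_ε(z_ε)(v_ε)` decays faster than every power of `ε`, then the generalized vector `[(v_ε)]`
is in the kernel of the form `[(s_ε(z_ε))]`, as tested on the standard basis. -/
theorem pointValue_sum_mem_negNum {s : ModBil (EuclideanSpace ℝ (Fin d)) M} {p : M}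
    {z : CompactNet (chartAt (EuclideanSpace ℝ (Fin d)) p).target}
    {v : Eps → EuclideanSpace ℝ (Fin d)} {V : Fin d → ModNum} (hV : ∀ i ε, (V i).1 ε = v ε i)
    (hv : ∀ m : ℕ, ∀ᶠ ε in epsZero, ‖loc (EuclideanSpace ℝ (Fin d))
      (EuclideanSpace ℝ (Fin d) →L[ℝ] (EuclideanSpace ℝ (Fin d) →L[ℝ] ℝ)) p (s.1 ε) (z.toFun ε)
        (v ε)‖ ≤ (ε : ℝ) ^ m) (j : Fin d) :
    ∑ i, ModBil.pointValue p z (EuclideanSpace.single i 1) (EuclideanSpace.single j 1) s * V i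
      ∈ NegNum := by
  intro m
  refine ⟨1, ?_⟩
  filter_upwards [hv m] with ε hε _ _
  have h1 : (∑ i, ModBil.pointValue p z (EuclideanSpace.single i 1)
      (EuclideanSpace.single j 1) s * V i).1 ε = loc (EuclideanSpace ℝ (Fin d))
      (EuclideanSpace ℝ (Fin d) →L[ℝ] (EuclideanSpace ℝ (Fin d) →L[ℝ] ℝ)) p (s.1 ε) (z.toFun ε)
        (v ε) (EuclideanSpace.single j 1) := by
    have h2 : v ε = ∑ i, v ε i • EuclideanSpace.single i (1 : ℝ) := by
      simpa using ((EuclideanSpace.basisFun (Fin d) ℝ).sum_repr (v ε)).symm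
    conv_rhs => rw [h2]
    rw [map_sum, sum_apply, AddSubmonoidClass.coe_finsetSum, Finset.sum_apply]
    refine Finset.sum_congr rfl fun i _ => ?_
    rw [map_smul, smul_apply, smul_eq_mul, ← hV, mul_comm]
    rfl
  rw [h1, one_mul]
  refine (ContinuousLinearMap.le_opNorm _ _).trans ?_
  simpa using hε

/-- A non-degenerate generalized two-tensor is bounded below by a power of `ε` on compact sets.
Otherwise there are `e n → 0`, points `y n` in a compact set and unit vectors `u n` for which
`s_{e n}(y n)(u n)` decays faster than every power of `e n`; they assemble to a generalized point
and a non-zero generalized vector in the kernel of the form at that point. -/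
theorem GenBil.Nondegenerate.belowOn {s : ModBil (EuclideanSpace ℝ (Fin d)) M}
    (hs : GenBil.Nondegenerate (GenSec.mk s : GenBil (EuclideanSpace ℝ (Fin d)) M)) (p : M)
    {K : Set (EuclideanSpace ℝ (Fin d))}
    (hK : K ⊆ (chartAt (EuclideanSpace ℝ (Fin d)) p).target) (hc : IsCompact K) :
    BelowOn K (fun ε => loc (EuclideanSpace ℝ (Fin d))
      (EuclideanSpace ℝ (Fin d) →L[ℝ] (EuclideanSpace ℝ (Fin d) →L[ℝ] ℝ)) p (s.1 ε)) := by
  by_contra h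
  have hbad : ∀ n : ℕ, ∃ ε : Eps, (ε : ℝ) < 1 / ((n : ℝ) + 1) ∧ ∃ y ∈ K,
      ∃ u : EuclideanSpace ℝ (Fin d), ‖u‖ = 1 ∧
      ‖loc (EuclideanSpace ℝ (Fin d))
        (EuclideanSpace ℝ (Fin d) →L[ℝ] (EuclideanSpace ℝ (Fin d) →L[ℝ] ℝ)) p (s.1 ε) y u‖
        ≤ (ε : ℝ) ^ n := by
    intro n
    have h1 := not_exists.1 h n
    obtain ⟨ε, h2, hε⟩ := ((not_eventually.1 h1).and_eventually
      (eventually_lt (δ := 1 / ((n : ℝ) + 1)) (by positivity))).exists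
    push Not at h2
    obtain ⟨y, hy, v, hv⟩ := h2
    have hv0 : v ≠ 0 := by
      rintro rfl
      simp at hv
    have hv1 : 0 < ‖v‖ := norm_pos_iff.2 hv0
    refine ⟨ε, hε, y, hy, ‖v‖⁻¹ • v, norm_smul_inv_norm hv0, ?_⟩
    rw [map_smul, norm_smul, norm_inv, norm_norm, inv_mul_le_iff₀ hv1, mul_comm]
    exact hv.le
  choose e he y hy u hu hsu using hbad
  -- an index `n` with `e n = ε`, if there is one; otherwise the value is irrelevant
  classical
  let idx : Eps → ℕ := fun ε => if h : ∃ n, e n = ε then h.choose else 0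
  have hidx : ∀ ε, ε ∈ range e → e (idx ε) = ε := by
    intro ε hε
    have h : ∃ n, e n = ε := hε
    simp only [idx, dif_pos h]
    exact h.choose_spec
  let z : CompactNet (chartAt (EuclideanSpace ℝ (Fin d)) p).target :=
    ⟨fun ε => y (idx ε), K, hK, hc, Eventually.of_forall fun ε => hy _⟩
  let v : Eps → EuclideanSpace ℝ (Fin d) := fun ε => if ε ∈ range e then u (idx ε) else 0
  have hv1 : ∀ ε, ‖v ε‖ ≤ 1 := by
    intro ε
    by_cases hε : ε ∈ range e
    · simp only [v, if_pos hε, hu, le_refl]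
    · simp only [v, if_neg hε, norm_zero, zero_le_one]
  let V : Fin d → ModNum := fun i => ⟨fun ε => v ε i, moderateOn_bound 1 fun ε _ _ =>
    (PiLp.norm_apply_le (v ε) i).trans (hv1 ε)⟩
  have hvs : ∀ m : ℕ, ∀ᶠ ε in epsZero, ‖loc (EuclideanSpace ℝ (Fin d))
      (EuclideanSpace ℝ (Fin d) →L[ℝ] (EuclideanSpace ℝ (Fin d) →L[ℝ] ℝ)) p (s.1 ε) (z.toFun ε)
        (v ε)‖ ≤ (ε : ℝ) ^ m := by
    intro m
    filter_upwards [eventually_le_index e m] with ε hm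
    have hε0 := ε.2.1
    by_cases hε : ε ∈ range e
    · have h1 := hsu (idx ε)
      rw [hidx ε hε] at h1
      simp only [v, if_pos hε]
      exact h1.trans (pow_le_pow_of_le_one ε.2.1.le ε.2.2 (hm _ (hidx ε hε)))
    · simp only [v, if_neg hε, map_zero, norm_zero]
      positivity
  -- `v` is in the kernel of the form at the generalized point `z`, hence negligible
  have hker := hs p z (fun i => GenReal.mk (V i)) fun w => by
    choose W hW using fun j => Ideal.Quotient.mk_surjective (I := NegNum) (w j)
    have hW' : ∀ j, w j = GenReal.mk (W j) := fun j => (hW j).symm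
    have hP : ∀ i j, GenBil.pointValue (GenSec.mk s) p z
        (EuclideanSpace.single i 1) (EuclideanSpace.single j 1) =
      GenReal.mk (ModBil.pointValue p z (EuclideanSpace.single i 1)
        (EuclideanSpace.single j 1) s) := fun _ _ => rfl
    simp only [hW', hP, ← map_mul, ← map_sum]
    rw [Finset.sum_comm]
    refine Ideal.Quotient.eq_zero_iff_mem.2 (sum_mem fun j _ => ?_)
    rw [← Finset.sum_mul]
    exact Ideal.mul_mem_right _ _ (pointValue_sum_mem_negNum (fun _ _ => rfl) hvs j)
  have hV0 : ∀ i, V i ∈ NegNum := fun i => Ideal.Quotient.eq_zero_iff_mem.1 (congrFun hker i)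
  -- but `v` has norm one along the sequence `e`
  have he0 : Tendsto (fun n => (e n : ℝ)) atTop (𝓝 0) :=
    squeeze_zero (fun n => (e n).2.1.le) (fun n => (he n).le) tendsto_one_div_add_atTop_nhds_zero_nat
  have he1 : Tendsto e atTop epsZero := tendsto_comap_iff.2 he0
  have hcoord : ∀ i, Tendsto (fun n => v (e n) i) atTop (𝓝 0) := by
    intro i
    obtain ⟨C, hC⟩ := hV0 i 1
    refine squeeze_zero_norm' (a := fun n => C * (e n : ℝ) ^ 1) ?_ (by simpa using he0.const_mul C)
    filter_upwards [he1.eventually hC] with n hn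
    exact hn () trivial
  have hsum : Tendsto (fun n => ∑ i, v (e n) i ^ 2) atTop (𝓝 0) := by
    simpa using tendsto_finsetSum Finset.univ fun i _ => (hcoord i).pow 2
  have hone : ∀ n, ∑ i, v (e n) i ^ 2 = 1 := by
    intro n
    rw [← EuclideanSpace.real_norm_sq_eq]
    simp only [v, if_pos (mem_range_self n), hu, one_pow]
  simp only [hone] at hsum
  exact one_ne_zero (tendsto_nhds_unique tendsto_const_nhds hsum)

end Nondegenerate

/-! ### Construction of smooth sections -/

section Construction

variable {E : Type*} [NormedAddCommGroup E] [NormedSpace ℝ E]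
  {M : Type*} [TopologicalSpace M] [ChartedSpace E M] [IsManifold 𝓘(ℝ, E) ∞ M]
  {F : Type*} [NormedAddCommGroup F] [NormedSpace ℝ F]
  {V : M → Type*} [TopologicalSpace (TotalSpace F V)] [∀ x, AddCommGroup (V x)]
  [∀ x, Module ℝ (V x)] [∀ x, TopologicalSpace (V x)] [FiberBundle F V] [VectorBundle ℝ F V]
  [ContMDiffVectorBundle ∞ F V 𝓘(ℝ, E)] [ChartAdapted E F V]
  {F₁ : Type*} [NormedAddCommGroup F₁] [NormedSpace ℝ F₁]
  {V₁ : M → Type*} [TopologicalSpace (TotalSpace F₁ V₁)] [∀ x, AddCommGroup (V₁ x)]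
  [∀ x, Module ℝ (V₁ x)] [∀ x, TopologicalSpace (V₁ x)] [FiberBundle F₁ V₁] [VectorBundle ℝ F₁ V₁]
  {F₂ : Type*} [NormedAddCommGroup F₂] [NormedSpace ℝ F₂]
  {V₂ : M → Type*} [TopologicalSpace (TotalSpace F₂ V₂)] [∀ x, AddCommGroup (V₂ x)]
  [∀ x, Module ℝ (V₂ x)] [∀ x, TopologicalSpace (V₂ x)] [FiberBundle F₂ V₂] [VectorBundle ℝ F₂ V₂]
  [∀ x, IsTopologicalAddGroup (V₂ x)] [∀ x, ContinuousSMul ℝ (V₂ x)]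
  [ContMDiffVectorBundle ∞ F₁ V₁ 𝓘(ℝ, E)] [ContMDiffVectorBundle ∞ F₂ V₂ 𝓘(ℝ, E)]
  [ChartAdapted E F₁ V₁] [ChartAdapted E F₂ V₂]

/-- The local section with coordinate expression `g` in the chart around `p`. -/
theorem contMDiffOn_symm_chart (p : M) {W : Set M} (hW : IsOpen W) (hWs : W ⊆ (chartAt E p).source)
    {g : E → F} (hg : ∀ x ∈ W, ContDiffAt ℝ ∞ g (chartAt E p x)) :
    ContMDiffOn 𝓘(ℝ, E) (𝓘(ℝ, E).prod 𝓘(ℝ, F)) ∞ (fun x => TotalSpace.mk' F x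
      ((trivializationAt F V p).symm x (g (chartAt E p x)))) W := by
  have hb : W ⊆ (trivializationAt F V p).baseSet := hWs.trans (ChartAdapted.source_subset p)
  rw [(trivializationAt F V p).contMDiffOn_section_iff hW hb]
  have h1 : ContMDiffOn 𝓘(ℝ, E) 𝓘(ℝ, F) ∞ (fun x => g (chartAt E p x)) W := fun x hx =>
    ((hg x hx).contMDiffAt.comp x (((contMDiffOn_chart (I := 𝓘(ℝ, E))).contMDiffAt
      ((chartAt E p).open_source.mem_nhds (hWs hx))))).contMDiffWithinAt
  refine h1.congr fun x hx => ?_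
  rw [(trivializationAt F V p).apply_mk_symm (hb hx)]

/-- A fixed smooth section is moderate. -/
theorem const_mem_modSec (s : Cₛ^∞⟮𝓘(ℝ, E); F, V⟯) : (fun _ : Eps => s) ∈ ModSec E F V := by
  intro p K hK hc k
  have hU := (chartAt E p).open_target
  have h1 : ContinuousOn (iteratedFDeriv ℝ k (loc E F p s)) K :=
    ((((contDiffOn_loc s p).continuousOn_iteratedFDerivWithin (m := k)
      (by exact_mod_cast le_top) hU.uniqueDiffOn)).congr
      fun x hx => (iteratedFDerivWithin_of_isOpen k hU hx).symm).mono hK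
  obtain ⟨C, hC⟩ := hc.exists_bound_of_continuousOn h1
  exact moderateOn_bound C fun ε x hx => hC x hx

omit [IsManifold 𝓘(ℝ, E) ∞ M] [ContMDiffVectorBundle ∞ F₁ V₁ 𝓘(ℝ, E)]
  [ContMDiffVectorBundle ∞ F₂ V₂ 𝓘(ℝ, E)] in
theorem loc_hom_apply (φ : ∀ x, V₁ x →L[ℝ] V₂ x) (p : M) {y : E} (hy : y ∈ (chartAt E p).target)
    (v : V₁ ((chartAt E p).symm y)) :
    (trivializationAt F₂ V₂ p ⟨_, φ _ v⟩).2 =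
      loc E (F₁ →L[ℝ] F₂) p φ y (trivializationAt F₁ V₁ p ⟨_, v⟩).2 := by
  have h1 := mem_baseSet F₁ V₁ hy
  have h2 := mem_baseSet F₂ V₂ hy
  simp only [loc, hom_trivializationAt_apply, ContinuousLinearMap.inCoordinates_eq h1 h2]
  simp [h1]

omit [IsManifold 𝓘(ℝ, E) ∞ M] [ContMDiffVectorBundle ∞ F₁ V₁ 𝓘(ℝ, E)]
  [ContMDiffVectorBundle ∞ F₂ V₂ 𝓘(ℝ, E)] in
theorem injective_loc_iff (φ : ∀ x, V₁ x →L[ℝ] V₂ x) (p : M) {y : E}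
    (hy : y ∈ (chartAt E p).target) :
    Function.Injective (loc E (F₁ →L[ℝ] F₂) p φ y) ↔
      Function.Injective (φ ((chartAt E p).symm y)) := by
  let e₁ := (trivializationAt F₁ V₁ p).continuousLinearEquivAt ℝ _ (mem_baseSet F₁ V₁ hy)
  let e₂ := (trivializationAt F₂ V₂ p).continuousLinearEquivAt ℝ _ (mem_baseSet F₂ V₂ hy)
  have h : loc E (F₁ →L[ℝ] F₂) p φ y ∘ e₁ = e₂ ∘ φ ((chartAt E p).symm y) :=
    funext fun v => (loc_hom_apply φ p hy v).symm
  rw [← Function.Injective.of_comp_iff' _ e₁.bijective, h, e₂.injective.of_comp_iff]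

theorem isInvertible_of_injective [FiniteDimensional ℝ F₁] [FiniteDimensional ℝ F₂]
    (hd : Module.finrank ℝ F₁ = Module.finrank ℝ F₂) {L : F₁ →L[ℝ] F₂}
    (hL : Function.Injective L) : L.IsInvertible :=
  ⟨(LinearMap.linearEquivOfInjective (L : F₁ →ₗ[ℝ] F₂) hL hd).toContinuousLinearEquiv,
    ContinuousLinearMap.ext fun _ => rfl⟩

variable [FiniteDimensional ℝ E] [SigmaCompactSpace M] [T2Space M]

/-- A linear equation for sections that is pointwise uniquely solvable on a closed set has a global
smooth section that solves it there. -/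
theorem exists_section_apply_eq [FiniteDimensional ℝ F₁] [FiniteDimensional ℝ F₂]
    (hd : Module.finrank ℝ F₁ = Module.finrank ℝ F₂)
    (φ : Cₛ^∞⟮𝓘(ℝ, E); F₁ →L[ℝ] F₂, fun x => V₁ x →L[ℝ] V₂ x⟯) (b : Cₛ^∞⟮𝓘(ℝ, E); F₂, V₂⟯)
    {A : Set M} (hA : IsClosed A) (hφ : ∀ x ∈ A, Function.Injective (φ x)) :
    ∃ s : Cₛ^∞⟮𝓘(ℝ, E); F₁, V₁⟯, ∀ x ∈ A, φ x (s x) = b x := by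
  refine exists_contMDiffSection_forall_mem_convex_of_local 𝓘(ℝ, E) (n := ⊤) V₁
    (fun x => {v | x ∈ A → φ x v = b x}) (fun x v hv w hw a c _ _ hac hx => ?_) fun p => ?_
  · rw [map_add, map_smul, map_smul, hv hx, hw hx, ← add_smul, hac, one_smul]
  by_cases hp : p ∈ A
  swap
  · exact ⟨Aᶜ, hA.isOpen_compl.mem_nhds hp, fun _ => 0,
      (0 : Cₛ^∞⟮𝓘(ℝ, E); F₁, V₁⟯).contMDiff.contMDiffOn, fun x hx hx' => absurd hx' hx⟩
  let S := loc E (F₁ →L[ℝ] F₂) p φ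
  let β := loc E F₂ p b
  have hS := contDiffOn_loc φ p
  have hβ := contDiffOn_loc b p
  have htgt := (chartAt E p).open_target
  have hinv : (S (chartAt E p p)).IsInvertible := by
    refine isInvertible_of_injective hd ((injective_loc_iff φ p (mem_chart_target E p)).2 ?_)
    rw [(chartAt E p).left_inv (mem_chart_source E p)]
    exact hφ p hp
  have hopen : {L : F₁ →L[ℝ] F₂ | L.IsInvertible} ∈ 𝓝 (S (chartAt E p p)) :=
    ContinuousLinearEquiv.isOpen.mem_nhds hinv
  -- near `p` the coordinate expression of `φ` is invertible, and its inverse is smooth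
  have hW : ∀ᶠ x in 𝓝 p, x ∈ (chartAt E p).source ∧ (S (chartAt E p x)).IsInvertible := by
    have h1 : ContinuousAt S (chartAt E p p) :=
      hS.continuousOn.continuousAt (htgt.mem_nhds (mem_chart_target E p))
    have h2 : ContinuousAt (chartAt E p) p :=
      (chartAt E p).continuousAt (mem_chart_source E p)
    exact Eventually.and (chart_source_mem_nhds E p) ((h1.comp h2).eventually hopen)
  obtain ⟨W, hWsub, hWo, hpW⟩ := mem_nhds_iff.1 hW
  refine ⟨W, hWo.mem_nhds hpW, fun x => (trivializationAt F₁ V₁ p).symm x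
    ((S (chartAt E p x)).inverse (β (chartAt E p x))),
    contMDiffOn_symm_chart p hWo (fun x hx => (hWsub hx).1)
      (g := fun y => (S y).inverse (β y)) fun x hx => ?_, fun x hx _ => ?_⟩
  · have hy := htgt.mem_nhds ((chartAt E p).map_source (hWsub hx).1)
    exact (((hWsub hx).2.contDiffAt_map_inverse).comp _ (hS.contDiffAt hy)).clm_apply
      (hβ.contDiffAt hy)
  · obtain ⟨y, hy, rfl⟩ : ∃ y ∈ (chartAt E p).target, (chartAt E p).symm y = x :=
      ⟨_, (chartAt E p).map_source (hWsub hx).1, (chartAt E p).left_inv (hWsub hx).1⟩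
    have hi := (hWsub hx).2
    beta_reduce
    rw [(chartAt E p).right_inv hy] at hi ⊢
    refine ((trivializationAt F₂ V₂ p).continuousLinearEquivAt ℝ _
      (mem_baseSet F₂ V₂ hy)).injective ?_
    refine (loc_hom_apply (F₁ := F₁) (F₂ := F₂) φ p hy _).trans ?_
    rw [(trivializationAt F₁ V₁ p).apply_mk_symm (mem_baseSet F₁ V₁ hy)]
    exact hi.self_apply_inverse _

/-- Every vector of the model fibre is the coordinate expression of a global smooth section on a
given compact subset of a chart. -/
theorem exists_section_loc_eq (p : M) {K : Set E} (hK : K ⊆ (chartAt E p).target)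
    (hc : IsCompact K) (c : F) :
    ∃ s : Cₛ^∞⟮𝓘(ℝ, E); F, V⟯, ∀ y ∈ K, loc E F p s y = c := by
  let A : Set M := (chartAt E p).symm '' K
  have hA : IsClosed A :=
    (hc.image_of_continuousOn ((chartAt E p).continuousOn_symm.mono hK)).isClosed
  have hAs : A ⊆ (chartAt E p).source := by
    rintro _ ⟨y, hy, rfl⟩
    exact (chartAt E p).map_target (hK hy)
  obtain ⟨s, hs⟩ : ∃ s : Cₛ^∞⟮𝓘(ℝ, E); F, V⟯, ∀ x, x ∈ A →
      s x = (trivializationAt F V p).symm x c := by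
    refine exists_contMDiffSection_forall_mem_convex_of_local 𝓘(ℝ, E) (n := ⊤) V
      (fun x => {v | x ∈ A → v = (trivializationAt F V p).symm x c})
      (fun x v hv w hw a b _ _ hab hx => by rw [hv hx, hw hx, ← add_smul, hab, one_smul])
      fun q => ?_
    by_cases hq : q ∈ A
    · exact ⟨_, (chartAt E p).open_source.mem_nhds (hAs hq), _,
        contMDiffOn_symm_chart p (chartAt E p).open_source subset_rfl
          (g := fun _ => c) fun _ _ => contDiffAt_const, fun _ _ _ => rfl⟩
    · exact ⟨Aᶜ, hA.isOpen_compl.mem_nhds hq, fun _ => 0,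
        (0 : Cₛ^∞⟮𝓘(ℝ, E); F, V⟯).contMDiff.contMDiffOn, fun x hx hx' => absurd hx' hx⟩
  refine ⟨s, fun y hy => ?_⟩
  rw [loc, hs _ (mem_image_of_mem _ hy), (trivializationAt F V p).apply_mk_symm
    (mem_baseSet F V (hK hy))]

end Construction

/-! ### The map `σ_♭` -/

section Flat

universe u

variable {E : Type u} [NormedAddCommGroup E] [NormedSpace ℝ E]
  {M : Type*} [TopologicalSpace M] [ChartedSpace E M] [IsManifold 𝓘(ℝ, E) ∞ M]

/-- The net of two-tensors `s_ε` is, as a net of maps `TM → T*M`, bounded below by powers of `ε` on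
the compact subsets of every chart. -/
def ModBil.LocBelow (s : ModBil E M) : Prop :=
  ∀ (p : M), ∀ K ⊆ (chartAt E p).target, IsCompact K →
    BelowOn K (fun ε => loc E (E →L[ℝ] (E →L[ℝ] ℝ)) p (s.1 ε))

theorem injective_of_pow_mul_norm_le {F₁ F₂ : Type*} [NormedAddCommGroup F₁] [NormedSpace ℝ F₁]
    [NormedAddCommGroup F₂] [NormedSpace ℝ F₂] {L : F₁ →L[ℝ] F₂} {c : ℝ} (hc : 0 < c)
    (h : ∀ v, c * ‖v‖ ≤ ‖L v‖) : Function.Injective L := by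
  refine (injective_iff_map_eq_zero L).2 fun v hv => ?_
  have := h v
  rw [hv, norm_zero] at this
  exact norm_le_zero_iff.1 (nonpos_of_mul_nonpos_right this hc)

theorem ModBil.LocBelow.mem_negSec {s : ModBil E M} (hs : s.LocBelow)
    {X : ModSec E E (Tan E M)} (h : ModSec.apply s X ∈ NegSec E (E →L[ℝ] ℝ) (Cotan E M)) :
    X ∈ NegSec E E (Tan E M) := fun p K hK hc =>
  (hs p K hK hc).negligibleOn
    ((h p K hK hc).congr fun ε _ hy => (loc_apply (s.1 ε) (X.1 ε) p (hK hy)).symm)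

theorem ModBil.LocBelow.eventually_injective [FiniteDimensional ℝ E] {s : ModBil E M}
    (hs : s.LocBelow) {C : Set M} (hC : IsCompact C) :
    ∀ᶠ ε in epsZero, ∀ x ∈ C, Function.Injective (s.1 ε x) := by
  have : ProperSpace E := FiniteDimensional.proper_real E
  refine hC.induction_on (p := fun C => ∀ᶠ ε in epsZero, ∀ x ∈ C, Function.Injective (s.1 ε x))
    (by simp) (fun A B hAB hB => hB.mono fun ε h x hx => h x (hAB hx))
    (fun A B hA hB => ?_) fun x _ => ?_
  · filter_upwards [hA, hB] with ε h1 h2 x hx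
    exact hx.elim (h1 x) (h2 x)
  · obtain ⟨K, hKx, hK, hc⟩ := local_compact_nhds
      ((chartAt E x).open_target.mem_nhds (mem_chart_target E x))
    refine ⟨(chartAt E x).source ∩ chartAt E x ⁻¹' K, mem_nhdsWithin_of_mem_nhds
      (inter_mem (chart_source_mem_nhds E x)
        ((chartAt E x).continuousAt (mem_chart_source E x) hKx)), ?_⟩
    obtain ⟨N, hN⟩ := hs x K hK hc
    filter_upwards [hN] with ε hN y hy
    have h1 := (injective_loc_iff (s.1 ε) x (hK hy.2)).1
      (injective_of_pow_mul_norm_le (pow_pos ε.2.1 N) (hN _ hy.2))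
    rwa [(chartAt E x).left_inv hy.1] at h1

theorem finrank_eq_finrank_dual [FiniteDimensional ℝ E] :
    Module.finrank ℝ E = Module.finrank ℝ (E →L[ℝ] ℝ) := by
  rw [← LinearEquiv.finrank_eq (LinearMap.toContinuousLinearMap (𝕜 := ℝ) (E := E) (F' := ℝ))]
  exact Subspace.dual_finrank_eq.symm

/-- The equation `s_ε(X_ε, ·) = α_ε` has smooth solutions `X_ε` on `M` such that, on a neighbourhood
of each compact set, it holds for all small `ε`: solve it, for each `ε`, on the union of the first
`⌊1/ε⌋` members of a compact exhaustion on which `s_ε` is injective. -/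
theorem ModBil.LocBelow.exists_solution [FiniteDimensional ℝ E] [SigmaCompactSpace M] [T2Space M]
    {s : ModBil E M} (hs : s.LocBelow)
    (α : Eps → Cₛ^∞⟮𝓘(ℝ, E); E →L[ℝ] ℝ, Cotan E M⟯) :
    ∃ X : Eps → Cₛ^∞⟮𝓘(ℝ, E); E, Tan E M⟯, ∀ C : Set M, IsCompact C →
      ∀ᶠ ε in epsZero, ∀ x ∈ C, ∀ᶠ x' in 𝓝 x, s.1 ε x' (X ε x') = α ε x' := by
  have : ProperSpace E := FiniteDimensional.proper_real E
  have : LocallyCompactSpace M := ChartedSpace.locallyCompactSpace E M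
  let Ke := CompactExhaustion.choice M
  let I : Eps → Set ℕ := fun ε =>
    {m | m ≤ ⌊(ε : ℝ)⁻¹⌋₊ ∧ ∀ x ∈ Ke m, Function.Injective (s.1 ε x)}
  have hI : ∀ ε, IsClosed (⋃ m ∈ I ε, Ke m) := fun ε =>
    ((finite_Iic ⌊(ε : ℝ)⁻¹⌋₊).subset fun m hm => hm.1).isClosed_biUnion fun m _ =>
      Ke.isClosed m
  have hsol : ∀ ε, ∃ X : Cₛ^∞⟮𝓘(ℝ, E); E, Tan E M⟯,
      ∀ x ∈ ⋃ m ∈ I ε, Ke m, s.1 ε x (X x) = α ε x := fun ε =>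
    exists_section_apply_eq finrank_eq_finrank_dual (s.1 ε) (α ε) (hI ε) fun x hx => by
      obtain ⟨m, hm, hx⟩ := mem_iUnion₂.1 hx
      exact hm.2 x hx
  choose X hX using hsol
  refine ⟨X, fun C hC => ?_⟩
  obtain ⟨m, hm⟩ := Ke.exists_superset_of_isCompact hC
  have hlarge : ∀ᶠ ε : Eps in epsZero, m + 1 ≤ ⌊(ε : ℝ)⁻¹⌋₊ := by
    filter_upwards [eventually_lt (δ := ((m : ℝ) + 1)⁻¹) (by positivity)] with ε hε
    refine Nat.le_floor ?_
    push_cast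
    exact (le_inv_comm₀ (by positivity) ε.2.1).2 hε.le
  filter_upwards [hlarge, hs.eventually_injective (Ke.isCompact (m + 1))] with ε h1 h2 x hx
  filter_upwards [mem_interior_iff_mem_nhds.1 (Ke.subset_interior_succ m (hm hx))] with x' hx'
  exact hX ε x' (mem_iUnion₂.2 ⟨m + 1, ⟨h1, h2⟩, hx'⟩)

/-- The solutions of `s_ε(X_ε, ·) = α_ε` on large sets form a moderate net. -/
theorem ModBil.LocBelow.exists_apply_sub_mem_negSec [FiniteDimensional ℝ E] [SigmaCompactSpace M]
    [T2Space M] {s : ModBil E M} (hs : s.LocBelow) (α : ModSec E (E →L[ℝ] ℝ) (Cotan E M)) :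
    ∃ X : ModSec E E (Tan E M), ModSec.apply s X - α ∈ NegSec E (E →L[ℝ] ℝ) (Cotan E M) := by
  obtain ⟨X, hX⟩ := hs.exists_solution α.1
  have hloc : ∀ p : M, ∀ K ⊆ (chartAt E p).target, IsCompact K → ∀ᶠ ε in epsZero, ∀ y ∈ K,
      (fun y => loc E (E →L[ℝ] (E →L[ℝ] ℝ)) p (s.1 ε) y (loc E E p (X ε) y)) =ᶠ[𝓝 y]
        loc E (E →L[ℝ] ℝ) p (α.1 ε) := by
    intro p K hK hc
    filter_upwards [hX _ (hc.image_of_continuousOn ((chartAt E p).continuousOn_symm.mono hK))]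
      with ε hε y hy
    have h1 := ((chartAt E p).continuousAt_symm (hK hy)).eventually (hε _ (mem_image_of_mem _ hy))
    filter_upwards [h1, (chartAt E p).open_target.mem_nhds (hK hy)] with y' h2 h3
    refine (loc_apply (s.1 ε) (X ε) p h3).symm.trans ?_
    exact congrArg (fun v => (trivializationAt (E →L[ℝ] ℝ) (Cotan E M) p ⟨_, v⟩).2) h2
  have hXm : X ∈ ModSec E E (Tan E M) := by
    intro p K hK hc k
    refine BelowOn.moderateOn_iteratedFDeriv (chartAt E p).open_target hK
      (B := ContinuousLinearMap.id ℝ (E →L[ℝ] (E →L[ℝ] ℝ)))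
      (fun ε => contDiffOn_loc (s.1 ε) p) (s.2 p K hK hc) k (hs p K hK hc)
      (fun ε => contDiffOn_loc (X ε) p) fun i _ => ?_
    refine (α.2 p K hK hc i).congr_eventually ?_
    filter_upwards [hloc p K hK hc] with ε hε y hy
    exact ((hε y hy).iteratedFDeriv ℝ i).eq_of_nhds
  refine ⟨⟨X, hXm⟩, fun p K hK hc m => ⟨0, ?_⟩⟩
  filter_upwards [hloc p K hK hc] with ε hε y hy
  have h1 := loc_add ((ModSec.apply s ⟨X, hXm⟩ - α).1 ε) (α.1 ε) p (hK hy)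
  have h2 : (ModSec.apply s ⟨X, hXm⟩ - α).1 ε + α.1 ε = (ModSec.apply s ⟨X, hXm⟩).1 ε :=
    sub_add_cancel ((ModSec.apply s ⟨X, hXm⟩).1 ε) (α.1 ε)
  rw [h2] at h1
  have h3 := (loc_apply (s.1 ε) (X ε) p (hK hy)).trans (hε y hy).eq_of_nhds
  have h4 := left_eq_add.1 (h3.symm.trans h1 |>.trans (add_comm _ _))
  rw [h4, norm_zero, zero_mul]

theorem GenBil.flat_add (σ : GenBil E M) (X Y : GenVF E M) :
    σ.flat (X + Y) = σ.flat X + σ.flat Y := by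
  obtain ⟨s, rfl⟩ := Submodule.Quotient.mk_surjective _ σ
  obtain ⟨X, rfl⟩ := Submodule.Quotient.mk_surjective _ X
  obtain ⟨Y, rfl⟩ := Submodule.Quotient.mk_surjective _ Y
  exact congrArg GenSec.mk (Subtype.ext (funext fun ε => ContMDiffSection.ext fun x =>
    map_add (s.1 ε x) (X.1 ε x) (Y.1 ε x)) :
      ModSec.apply s (X + Y) = ModSec.apply s X + ModSec.apply s Y)

theorem GenBil.flat_smul (σ : GenBil E M) (f : GenFun E M) (X : GenVF E M) :
    σ.flat (f • X) = f • σ.flat X := by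
  obtain ⟨s, rfl⟩ := Submodule.Quotient.mk_surjective _ σ
  obtain ⟨X, rfl⟩ := Submodule.Quotient.mk_surjective _ X
  obtain ⟨f, rfl⟩ := Ideal.Quotient.mk_surjective f
  exact congrArg GenSec.mk (Subtype.ext (funext fun ε => ContMDiffSection.ext fun x =>
    map_smul (s.1 ε x) (f.1 ε x) (X.1 ε x)) :
      ModSec.apply s (f • X) = f • ModSec.apply s X)

theorem ModBil.LocBelow.flat_injective {s : ModBil E M} (hs : s.LocBelow) :
    Function.Injective (GenBil.flat (GenSec.mk s : GenBil E M)) := by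
  have h0 : ∀ X, GenBil.flat (GenSec.mk s : GenBil E M) X = 0 → X = 0 := by
    intro X hX
    obtain ⟨X, rfl⟩ := Submodule.Quotient.mk_surjective _ X
    exact (Submodule.Quotient.mk_eq_zero _).2
      (hs.mem_negSec ((Submodule.Quotient.mk_eq_zero _).1 hX))
  exact (injective_iff_map_eq_zero
    (AddMonoidHom.mk' (GenBil.flat (GenSec.mk s : GenBil E M)) (GenBil.flat_add _))).2 h0

theorem ModBil.LocBelow.flat_surjective [FiniteDimensional ℝ E] [SigmaCompactSpace M]
    [T2Space M] {s : ModBil E M} (hs : s.LocBelow) :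
    Function.Surjective (GenBil.flat (GenSec.mk s : GenBil E M)) := by
  intro α
  obtain ⟨α, rfl⟩ := Submodule.Quotient.mk_surjective _ α
  obtain ⟨X, hX⟩ := hs.exists_apply_sub_mem_negSec α
  exact ⟨GenSec.mk X, (Submodule.Quotient.eq _).2 hX⟩

/-- A generalized one-form is determined by its values on generalized vector fields, since these
include the coordinate fields of every chart, cut off outside a compact set. -/
theorem GenOneForm.ext_eval [FiniteDimensional ℝ E] [SigmaCompactSpace M] [T2Space M]
    {α β : GenOneForm E M} (h : ∀ Y, α.eval Y = β.eval Y) : α = β := by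
  obtain ⟨a, rfl⟩ := Submodule.Quotient.mk_surjective _ α
  obtain ⟨b, rfl⟩ := Submodule.Quotient.mk_surjective _ β
  refine (Submodule.Quotient.eq _).2 fun p K hK hc m => ?_
  let v := Module.finBasis ℝ E
  have hcoord : ∀ i, ∃ C : ℝ, ∀ᶠ ε in epsZero, ∀ y ∈ K,
      ‖loc E (E →L[ℝ] ℝ) p ((a - b).1 ε) y (v i)‖ ≤ C * (ε : ℝ) ^ m := by
    intro i
    obtain ⟨Y, hY⟩ := exists_section_loc_eq (V := Tan E M) p hK hc (v i)
    let Y' : ModSec E E (Tan E M) := ⟨fun _ => Y, const_mem_modSec Y⟩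
    have h1 : ModSec.toModFun (ModSec.apply a Y') - ModSec.toModFun (ModSec.apply b Y') ∈
        NegFun E M :=
      Ideal.Quotient.eq.1 (h (GenSec.mk Y'))
    obtain ⟨C, hC⟩ := h1 p K hK hc m
    refine ⟨C, hC.mono fun ε hε y hy => ?_⟩
    have h2 := loc_apply (F₁ := E) (F₂ := ℝ) ((a - b).1 ε) Y p (hK hy)
    rw [← hY y hy]
    exact (congrArg norm h2).symm.trans_le (hε y hy)
  choose C hC using hcoord
  refine ⟨(Fintype.card (Fin (Module.finrank ℝ E)) • ‖v.equivFunL.toContinuousLinearMap‖) *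
    ∑ i, |C i|, ?_⟩
  filter_upwards [eventually_all.2 hC] with ε hε y hy
  have hε0 := ε.2.1
  rw [mul_assoc]
  refine v.opNorm_le (by positivity) fun i => (hε i y hy).trans ?_
  gcongr
  exact (le_abs_self _).trans (Finset.single_le_sum (fun j _ => abs_nonneg (C j))
    (Finset.mem_univ i))

end Flat

end Colombeau

end

theorem mainTheorem2 (d : ℕ) (M : Type*) [TopologicalSpace M] [T2Space M]
    [SecondCountableTopology M] [ChartedSpace (EuclideanSpace ℝ (Fin d)) M]
    [IsManifold (𝓡 d) ∞ M]
    (σ : Colombeau.GenBil (EuclideanSpace ℝ (Fin d)) M) (hσ : Colombeau.IsGenSymplectic σ) :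
    -- `σ_♭ X` is the unique generalized one-form with `(σ_♭ X)(Y) = σ(X, Y)` for all `Y`
    (∀ (X : Colombeau.GenVF (EuclideanSpace ℝ (Fin d)) M)
      (α : Colombeau.GenOneForm (EuclideanSpace ℝ (Fin d)) M),
      α = σ.flat X ↔ ∀ Y, α.eval Y = σ.eval X Y) ∧
    -- `σ_♭` is a `𝒢(M)`-linear isomorphism with inverse `σ^♯`
    (∃ e : Colombeau.GenVF (EuclideanSpace ℝ (Fin d)) M
        ≃ₗ[Colombeau.GenFun (EuclideanSpace ℝ (Fin d)) M]
        Colombeau.GenOneForm (EuclideanSpace ℝ (Fin d)) M,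
      (∀ X, e X = σ.flat X) ∧ ∀ α, e.symm α = σ.sharp α) ∧
    -- `H_f = σ^♯(df)` is the unique generalized vector field with `σ_♭(H_f) = df`
    (∀ (f : Colombeau.GenFun (EuclideanSpace ℝ (Fin d)) M)
      (X : Colombeau.GenVF (EuclideanSpace ℝ (Fin d)) M),
      X = σ.hamiltonian f ↔ σ.flat X = f.d) ∧
    -- the Poisson bracket is `{f, g} = σ(H_f, H_g)`, where `σ_♭(H_f) = df` and `σ_♭(H_g) = dg`
    (∀ (f g : Colombeau.GenFun (EuclideanSpace ℝ (Fin d)) M)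
      (X Y : Colombeau.GenVF (EuclideanSpace ℝ (Fin d)) M),
      σ.flat X = f.d → σ.flat Y = g.d → σ.poisson f g = σ.eval X Y) := by
  have : LocallyCompactSpace M :=
    ChartedSpace.locallyCompactSpace (EuclideanSpace ℝ (Fin d)) M
  obtain ⟨s, rfl⟩ := Submodule.Quotient.mk_surjective _ σ
  have hs : Colombeau.ModBil.LocBelow s := fun p _ hK hc => hσ.nondegenerate.belowOn p hK hc
  have hinj := hs.flat_injective
  have hsurj := hs.flat_surjective
  let σ : Colombeau.GenBil (EuclideanSpace ℝ (Fin d)) M := Colombeau.GenSec.mk s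
  have hsharp : ∀ α, σ.flat (σ.sharp α) = α := Function.rightInverse_invFun hsurj
  have hham : ∀ f X, X = σ.hamiltonian f ↔ σ.flat X = f.d := fun f X =>
    ⟨fun h => h ▸ hsharp f.d, fun h => hinj (h.trans (hsharp f.d).symm)⟩
  refine ⟨fun X α => ⟨fun h Y => h ▸ rfl, fun h => Colombeau.GenOneForm.ext_eval h⟩, ?_, hham,
    fun f g X Y hX hY => ?_⟩
  · refine ⟨LinearEquiv.ofBijective
      { toFun := σ.flat, map_add' := σ.flat_add, map_smul' := σ.flat_smul } ⟨hinj, hsurj⟩,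
      fun X => rfl, fun α => ?_⟩
    rw [LinearEquiv.symm_apply_eq]
    exact (hsharp α).symm
  · rw [(hham f X).2 hX, (hham g Y).2 hY]
    rfl
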